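/- Let $q$ be a prime power, let $n\ge 3$ be odd, put $m=(q^n+1)/(q+1)$, and let $s$ be a positive divisor of $m$. Let $\mathbb K$ be an algebraic closure of $\mathbb F_{q^{2n}}$ and let $\tilde{\mathcal Y}_{n,s}$ be the function field $\mathbb F_{q^{2n}}(x,y,z)$ with $$z^{m/s}=y\,\frac{x^{q^2}-x}{x^{q+1}-1},\qquad y^{q+1}=x^{q+1}-1 .$$ Automorphisms and places of $\tilde{\mathcal Y}_{n,s}$ are understood geometrically: $\mathrm{Aut}(\tilde{\mathcal Y}_{n,s})$ is the group of $\mathbb K$-automorphisms of $\mathbb K(x,y,z)$, acting on the places of $\mathbb K(x,y,z)/\mathbb K$. Let $M_\ell$ be the group of matrices $\begin{pmatrix} a&b\\ c&d\end{pmatrix}$ over $\mathbb F_{q^2}$ with $d^{q+1}-b^{q+1}=1$, $a^{q+1}-c^{q+1}=1$ and $-a^qb+c^qd=0$; for each of them there is a unique $\zeta$ with $\zeta^{q+1}=1$, $b=\zeta c^q$ and $d=\zeta a^q$. Let $O_\infty$ be the set of places lying over the poles of $x$ in $\mathbb K(x,y)$, and let $O$ be the set of places lying over the common zeros of $x-a$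 and $y-b$ in $\mathbb K(x,y)$, where $a,b\in\mathbb F_{q^2}$ and $b^{q+1}-a^{q+1}+1=0$. Then for every matrix in $M_\ell$, with associated $\zeta$, and every $\xi\in\mathbb F_{q^{2n}}$ with $\xi^{m/s}=\zeta$, there is an automorphism $$(x,y,z)\mapsto(ax+by,\;cx+dy,\;\xi z)$$ in $\mathrm{Aut}(\tilde{\mathcal Y}_{n,s})$. These automorphisms form a subgroup $G$, and $G$ is isomorphic to a semidirect product $\mathrm{SL}(2,q)\rtimes C_{(q^n+1)/s}$, where $C_N$ is the cyclic group of order $N$. Among the orbits of $G$ on the places, exactly two are short (that is, have length different from $|G|$), namely $O_\infty$ and $O$, and these are distinct. -/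

import Mathlib

open scoped Pointwise

/-! ### Places of a function field -/

/-- A place of the function field `F / K`, given by its valuation ring: a valuation ring of `F`
that contains the constants and is not all of `F`. -/
@[ext]
structure Place (K F : Type*) [Field K] [Field F] [Algebra K F] where
  ring : ValuationSubring F
  constants_mem : ∀ c : K, algebraMap K F c ∈ ring
  ne_top : ring ≠ ⊤

namespace Place

variable {K F : Type*} [Field K] [Field F] [Algebra K F]

/-- `f` has a pole at `P`. -/
def IsPole (P : Place K F) (f : F) : Prop := f ∉ P.ring

/-- `f` has a zero at `P`, that is, `f` lies in the maximal ideal of the valuation ring. -/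
def IsZero (P : Place K F) (f : F) : Prop := P.ring.valuation f < 1

/-- `σ(P)`: the valuation ring is moved to its image under the automorphism `σ`. -/
def map (σ : F ≃ₐ[K] F) (P : Place K F) : Place K F where
  ring := σ • P.ring
  constants_mem c := by
    have h := ValuationSubring.smul_mem_pointwise_smul σ _ P.ring (P.constants_mem c)
    simpa using h
  ne_top h := P.ne_top <| by
    have h2 : P.ring = σ⁻¹ • (⊤ : ValuationSubring F) := by rw [← h, inv_smul_smul]
    rw [h2]
    ext f
    simp [ValuationSubring.mem_inv_pointwise_smul_iff]

instance : MulAction (F ≃ₐ[K] F) (Place K F) where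
  smul := map
  one_smul P := Place.ext (one_smul _ P.ring)
  mul_smul σ τ P := Place.ext (mul_smul σ τ P.ring)

theorem mem_smul_iff (σ : F ≃ₐ[K] F) (P : Place K F) (f : F) :
    f ∈ (σ • P).ring ↔ ∃ g ∈ P.ring, σ g = f :=
  ValuationSubring.mem_smul_pointwise_iff_exists σ f P.ring

end Place

/-- The set of short orbits of a group `G` acting on a set `X`: the orbits whose
length differs from the order of `G`. -/
def shortOrbits (G X : Type*) [Group G] [MulAction G X] : Set (Set X) :=
  {o | (∃ P : X, o = MulAction.orbit G P) ∧ Nat.card o ≠ Nat.card G}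

/-! ### The function field -/

noncomputable section

/-- An algebraic closure of the rational function field `K(x)`. -/
abbrev RatClosure (K : Type*) [Field K] : Type _ := AlgebraicClosure (RatFunc K)

/-- The variable `x` of `K(x)`, seen in the algebraic closure of `K(x)`. -/
def xGen (K : Type*) [Field K] : RatClosure K := algebraMap (RatFunc K) (RatClosure K) RatFunc.X

/-- `m = (q ^ n + 1) / (q + 1)`, an integer for odd `n`. -/
def bmExp (q n : ℕ) : ℕ := (q ^ n + 1) / (q + 1)

/-- A solution `(y, z)`, in the algebraic closure of `K(x)`, of the two defining equations. -/
structure YTildeGens (K : Type*) [Field K] (q n s : ℕ) where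
  y : RatClosure K
  z : RatClosure K
  z_pow : z ^ (bmExp q n / s) =
    y * ((xGen K ^ (q ^ 2) - xGen K) / (xGen K ^ (q + 1) - 1))
  y_pow : y ^ (q + 1) = xGen K ^ (q + 1) - 1

/-- Solutions exist as soon as `m / s` is positive. -/
theorem YTildeGens.exists_of_pos (K : Type*) [Field K] (q n s : ℕ) (h : 0 < bmExp q n / s) :
    Nonempty (YTildeGens K q n s) := by
  obtain ⟨y, hy⟩ := IsAlgClosed.exists_pow_nat_eq (xGen K ^ (q + 1) - 1) (Nat.succ_pos q)
  obtain ⟨z, hz⟩ := IsAlgClosed.exists_pow_nat_eq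
    (y * ((xGen K ^ (q ^ 2) - xGen K) / (xGen K ^ (q + 1) - 1))) h
  exact ⟨⟨y, z, hz, hy⟩⟩

namespace YTildeGens

variable {K : Type*} [Field K] {q n s : ℕ} (g : YTildeGens K q n s)

/-- The function field `K(x, y, z)`. -/
abbrev field : IntermediateField K (RatClosure K) :=
  IntermediateField.adjoin K {xGen K, g.y, g.z}

/-- The generator `x` of `K(x, y, z)`. -/
def X : g.field := ⟨xGen K, IntermediateField.subset_adjoin _ _ (by simp)⟩

/-- The generator `y` of `K(x, y, z)`. -/
def Y : g.field := ⟨g.y, IntermediateField.subset_adjoin _ _ (by simp)⟩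

/-- The generator `z` of `K(x, y, z)`. -/
def Z : g.field := ⟨g.z, IntermediateField.subset_adjoin _ _ (by simp)⟩

/-- The places of `K(x, y, z)` over the poles of `x` in the Hermitian function field `K(x, y)`. -/
def orbitInfty : Set (Place K g.field) := {P | P.IsPole g.X}

/-- The places of `K(x, y, z)` over the common zeros of `x - a` and `y - b` in the Hermitian
function field `K(x, y)`, where `a, b` are in `𝔽_{q²}` and `b^(q+1) - a^(q+1) + 1 = 0`. -/
def orbitZero : Set (Place K g.field) :=
  {P | ∃ a b : K, a ^ (q ^ 2) = a ∧ b ^ (q ^ 2) = b ∧ b ^ (q + 1) - a ^ (q + 1) + 1 = 0 ∧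
    P.IsZero (g.X - algebraMap K g.field a) ∧ P.IsZero (g.Y - algebraMap K g.field b)}

end YTildeGens

/-! ### The automorphisms -/

/-- The matrices `!![a, b; c, d]` with entries in the subfield `𝔽_{q²}` of `k` that describe the
maximal subgroup `M_ℓ` of the automorphism group of the Hermitian function field, through
`x ↦ a x + b y`, `y ↦ c x + d y`. -/
def hermitianMl (k : Type*) [Field k] (q : ℕ) : Set (Matrix (Fin 2) (Fin 2) k) :=
  {A | (∀ i j, A i j ^ (q ^ 2) = A i j) ∧
    A 1 1 ^ (q + 1) - A 0 1 ^ (q + 1) = 1 ∧ A 0 0 ^ (q + 1) - A 1 0 ^ (q + 1) = 1 ∧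
    -(A 0 0 ^ q * A 0 1) + A 1 0 ^ q * A 1 1 = 0}

/-- The pairs `(A, ξ)`, where `A = !![a, ζ c^q; c, ζ a^q]` is in `M_ℓ`, `ζ^(q+1) = 1` and
`ξ^(m/s) = ζ`. -/
def liftParams (k : Type*) [Field k] (q n s : ℕ) : Set (Matrix (Fin 2) (Fin 2) k × k) :=
  {t | t.1 ∈ hermitianMl k q ∧ ∃ ζ : k, ζ ^ (q + 1) = 1 ∧
    t.1 0 1 = ζ * t.1 1 0 ^ q ∧ t.1 1 1 = ζ * t.1 0 0 ^ q ∧ t.2 ^ (bmExp q n / s) = ζ}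

/-- The `K`-automorphism `σ` of `K(x, y, z)` is
`(x, y, z) ↦ (a x + b y, c x + d y, ξ z)` for `t = (!![a, b; c, d], ξ)`. -/
def YTildeGens.IsLift {k K : Type*} [Field k] [Field K] [Algebra k K] {q n s : ℕ}
    (g : YTildeGens K q n s) (t : Matrix (Fin 2) (Fin 2) k × k)
    (σ : g.field ≃ₐ[K] g.field) : Prop :=
  σ g.X = algebraMap k K (t.1 0 0) • g.X + algebraMap k K (t.1 0 1) • g.Y ∧
  σ g.Y = algebraMap k K (t.1 1 0) • g.X + algebraMap k K (t.1 1 1) • g.Y ∧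
  σ g.Z = algebraMap k K t.2 • g.Z

end

/-!
Let `N = m / s`, and let `F = K(x, y, z)`.

**The field.** Put `D = (X ^ q² - X) / (X ^ (q + 1) - 1)`, a polynomial. The equations give
`z ^ N = y D(x)`, so that `y` lies in `K(x, z)`, and
`z ^ (N (q + 1)) = D(x) ^ (q + 1) (x ^ (q + 1) - 1)`. The right-hand side has a simple zero at
`x = 1`; by Eisenstein, `F` is obtained from `K(x)` by adjoining a root of an irreducible binomial
(`irreducible_kummer`), and every nonconstant solution of the two equations in a field over `K` is
the image of `(x, y, z)` (`IsYTildePoint.exists_algHom`).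

**The group.** A unitary matrix of determinant `ζ` preserves the Hermitian equation, and multiplies
`(x ^ q² - x) / y ^ q = (y ^ q² - y) / x ^ q = z ^ N` by `ζ` (`kummer_rhs_transform`). Hence the
group of the pairs `(A, ξ)` with `A` unitary and `ξ ^ N = det A` acts on `F`
(`IsYTildePoint.exists_action`). The projection to `ξ` has the section
`ξ ↦ (diag(1, ξ ^ N), ξ)`, and its kernel is the special unitary group of a form in two variables,
which is conjugate to `SL(2, q)` (`nonempty_liftGroup_mulEquiv`).

**The short orbits.** At a place that is not a pole of `x`, the functions `x` and `y` have values
`a` and `b` in `K`. If `a`, `b` are not both in the field of order `q²`, then no unitary matrix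
other than the identity fixes `(a, b)`, and `z` has a nonzero value, so that the stabilizer of the
place is trivial (`IsYTildePoint.eq_one_of_smul_eq`). The other places that are not poles of `x` can
be moved to `x = 1`, and the poles of `x` to poles with `y / x = 1`. In both cases there is only one
such place, because it is totally ramified over a rational function field, namely `K(x)` or `K(y / x)`
(`IsYTildePoint.subsingleton_isZero_sub_one`, `IsYTildePoint.subsingleton_isPole`). Therefore the
two sets are orbits, and they are short since some `g ≠ 1` preserves the condition that singles out
the place. Total ramification is proved by comparing values: in a sum `∑ aᵢ tⁱ` the terms
have pairwise different values, so that the valuation is determined by its restriction to the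
smaller field (`IsCommonUniformizer.of_ramified`).
-/

/-! ### Valuations at places -/

namespace Place

variable {K F : Type*} [Field K] [Field F] [Algebra K F]

theorem isZero_smul_iff (σ : F ≃ₐ[K] F) (P : Place K F) (f : F) :
    (σ • P).IsZero f ↔ P.IsZero (σ⁻¹ f) := by
  have key : ∀ (V : ValuationSubring F) (f : F), V.valuation f < 1 ↔ f = 0 ∨ f⁻¹ ∉ V := by
    intro V f
    by_cases hf : f = 0
    · simp [hf]
    · rw [← V.valuation_le_one_iff, not_le, map_inv₀, one_lt_inv₀]
      · simp [hf]
      · simpa [zero_lt_iff] using hf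
  unfold IsZero
  rw [key, key]
  have : f⁻¹ ∈ (σ • P).ring ↔ (σ⁻¹ f)⁻¹ ∈ P.ring := by
    rw [mem_smul_iff]
    constructor
    · rintro ⟨g, hg, h⟩
      rw [← map_inv₀, ← h]
      simpa [← AlgEquiv.mul_apply] using hg
    · intro h
      exact ⟨_, h, by rw [← map_inv₀, ← AlgEquiv.mul_apply]; simp⟩
  rw [this]
  simp

theorem isPole_smul_iff (σ : F ≃ₐ[K] F) (P : Place K F) (f : F) :
    (σ • P).IsPole f ↔ P.IsPole (σ⁻¹ f) := by
  unfold IsPole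
  rw [mem_smul_iff, not_iff_not]
  constructor
  · rintro ⟨g, hg, rfl⟩
    simpa [← AlgEquiv.mul_apply] using hg
  · intro h
    exact ⟨_, h, by rw [← AlgEquiv.mul_apply]; simp⟩

variable (P : Place K F)

theorem valuation_algebraMap {c : K} (hc : c ≠ 0) : P.ring.valuation (algebraMap K F c) = 1 := by
  have h1 := (P.ring.valuation_le_one_iff _).2 (P.constants_mem c)
  have h2 := (P.ring.valuation_le_one_iff _).2 (P.constants_mem c⁻¹)
  rw [map_inv₀, map_inv₀] at h2
  refine le_antisymm h1 ?_
  have h0 : 0 < P.ring.valuation (algebraMap K F c) := by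
    simpa [zero_lt_iff] using hc
  exact (inv_le_one₀ h0).1 h2

theorem IsZero.algebraMap_eq_zero {P : Place K F} {c : K} (h : P.IsZero (algebraMap K F c)) :
    c = 0 := by
  by_contra hc
  exact absurd (P.valuation_algebraMap hc) (ne_of_lt h)

theorem IsZero.add {P : Place K F} {f g : F} (hf : P.IsZero f) (hg : P.IsZero g) :
    P.IsZero (f + g) := P.ring.valuation.map_add_lt hf hg

theorem IsZero.sub {P : Place K F} {f g : F} (hf : P.IsZero f) (hg : P.IsZero g) :
    P.IsZero (f - g) := P.ring.valuation.map_sub_lt hf hg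

theorem IsZero.mem {P : Place K F} {f : F} (hf : P.IsZero f) : f ∈ P.ring :=
  (P.ring.valuation_le_one_iff _).1 (le_of_lt hf)

theorem IsZero.mul_mem {P : Place K F} {f g : F} (hf : P.IsZero f) (hg : g ∈ P.ring) :
    P.IsZero (g * f) := by
  unfold IsZero
  rw [map_mul]
  exact (mul_le_of_le_one_left zero_le ((P.ring.valuation_le_one_iff _).2 hg)).trans_lt hf

theorem IsZero.smul {P : Place K F} {f : F} (hf : P.IsZero f) (c : K) :
    P.IsZero (algebraMap K F c * f) := hf.mul_mem (P.constants_mem c)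

theorem isZero_pow {P : Place K F} {f : F} {n : ℕ} (hn : n ≠ 0) :
    P.IsZero (f ^ n) ↔ P.IsZero f := by
  unfold IsZero
  rw [map_pow, pow_lt_one_iff hn]

theorem mem_of_sub_isZero {P : Place K F} {f : F} {c : K} (h : P.IsZero (f - algebraMap K F c)) :
    f ∈ P.ring := by
  simpa using add_mem h.mem (P.constants_mem c)

/-- A function has at most one value at a place. -/
theorem value_unique {P : Place K F} {f : F} {c d : K} (hc : P.IsZero (f - algebraMap K F c))
    (hd : P.IsZero (f - algebraMap K F d)) : c = d := by
  have := (hd.sub hc).smul 1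
  rw [map_one, one_mul, sub_sub_sub_cancel_left, ← map_sub] at this
  exact sub_eq_zero.1 this.algebraMap_eq_zero

/-- Evaluation of polynomials at the value of a function. -/
theorem isZero_aeval_sub {P : Place K F} {f : F} {c : K} (h : P.IsZero (f - algebraMap K F c))
    (p : Polynomial K) : P.IsZero (Polynomial.aeval f p - algebraMap K F (p.eval c)) := by
  obtain ⟨r, hr⟩ := Polynomial.X_sub_C_dvd_sub_C_eval (p := p) (a := c)
  have := congrArg (Polynomial.aeval f) hr
  simp only [map_sub, map_mul, Polynomial.aeval_X, Polynomial.aeval_C] at this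
  rw [this, mul_comm]
  refine h.mul_mem ?_
  have hf := mem_of_sub_isZero h
  rw [Polynomial.aeval_eq_sum_range]
  refine sum_mem fun i _ => ?_
  rw [Algebra.smul_def]
  exact mul_mem (P.constants_mem _) (pow_mem hf _)

/-- If a nonzero polynomial in `f` vanishes at `P`, then one of its roots is the value of `f`. -/
theorem exists_root_value [IsAlgClosed K] {P : Place K F} {f : F} {p : Polynomial K} (hp : p ≠ 0)
    (h : P.IsZero (Polynomial.aeval f p)) :
    ∃ c, p.eval c = 0 ∧ P.IsZero (f - algebraMap K F c) := by
  by_contra! hcon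
  have hs := (IsAlgClosed.splits p).eq_prod_roots
  rw [hs, map_mul, Polynomial.aeval_C, map_multiset_prod, Multiset.map_map] at h
  unfold IsZero at h
  rw [map_mul, P.valuation_algebraMap (by simpa using hp), one_mul, map_multiset_prod,
    Multiset.map_map] at h
  refine absurd h (not_lt.2 (Multiset.one_le_prod_of_one_le ?_))
  intro a ha
  obtain ⟨c, hc, rfl⟩ := Multiset.mem_map.1 ha
  have := hcon c ((Polynomial.mem_roots hp).1 hc)
  simpa [IsZero] using this

/-- A function that is transcendental over the constants has a zero. -/
theorem exists_isZero {t : F} (ht : Transcendental K t) : ∃ P : Place K F, P.IsZero t := by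
  let A : Subring F := (Algebra.adjoin K {t}).toSubring
  have htA : t ∈ A := Algebra.subset_adjoin (Set.mem_singleton t)
  let I : Ideal A := Ideal.span {⟨t, htA⟩}
  have hI : I ≠ ⊤ := by
    rw [Ne, Ideal.eq_top_iff_one, Ideal.mem_span_singleton']
    rintro ⟨⟨a, ha⟩, h⟩
    have ha' : a ∈ Algebra.adjoin K {t} := ha
    rw [Algebra.adjoin_singleton_eq_range_aeval] at ha'
    obtain ⟨p, rfl⟩ := ha'
    have h' : Polynomial.aeval t p * t = 1 := congrArg Subtype.val h
    refine ht ⟨p * Polynomial.X - 1, ?_, by simp [h']⟩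
    intro h0
    have := congrArg (Polynomial.eval 0) h0
    simp at this
  obtain ⟨V, hV, hIV⟩ := Ideal.image_subset_nonunits_valuationSubring I hI
  have htV : V.valuation t < 1 :=
    (V.mem_nonunits_iff).1 (hIV ⟨⟨t, htA⟩, Ideal.subset_span rfl, rfl⟩)
  refine ⟨⟨V, fun c => hV (Subalgebra.algebraMap_mem _ c), ?_⟩, htV⟩
  rintro rfl
  have h0 : t ≠ 0 := by
    rintro rfl
    exact ht isAlgebraic_zero
  have h1 := ((⊤ : ValuationSubring F).valuation_le_one_iff t⁻¹).2 trivial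
  rw [map_inv₀, inv_le_one₀ (by simpa [zero_lt_iff] using h0)] at h1
  exact absurd htV (not_lt.2 h1)

end Place

/-! ### Total ramification -/

section Ramification

variable {K F : Type*} [Field K] [Field F] [Algebra K F]

/-- `π` is a common uniformizer, on the set `E` of functions, of all the places in `𝒱`: the value
of a nonzero `f ∈ E` is a power of the value of `π`, with an exponent that does not depend on the
place. If `E` is the whole field, then `𝒱` has at most one element. -/
def IsCommonUniformizer (𝒱 : Set (Place K F)) (E : Set F) (π : F) : Prop :=
  π ≠ 0 ∧ (∀ P ∈ 𝒱, P.IsZero π) ∧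
    ∀ f ∈ E, f ≠ 0 → ∃ k : ℤ, ∀ P ∈ 𝒱, P.ring.valuation f = P.ring.valuation π ^ k

theorem IsCommonUniformizer.subsingleton {𝒱 : Set (Place K F)} {π : F}
    (h : IsCommonUniformizer 𝒱 Set.univ π) : 𝒱.Subsingleton := by
  obtain ⟨h0, hz, hd⟩ := h
  intro P hP Q hQ
  have key : ∀ P ∈ 𝒱, ∀ k : ℤ, P.ring.valuation π ^ k ≤ 1 ↔ 0 ≤ k := by
    intro P hP k
    exact zpow_le_one_iff_right_of_lt_one₀ (by simpa [zero_lt_iff] using h0) (hz P hP)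
  refine Place.ext (SetLike.ext fun f => ?_)
  by_cases hf : f = 0
  · subst hf
    exact iff_of_true (zero_mem _) (zero_mem _)
  obtain ⟨k, hk⟩ := hd f trivial hf
  rw [← ValuationSubring.valuation_le_one_iff, ← ValuationSubring.valuation_le_one_iff, hk P hP,
    hk Q hQ, key P hP, key Q hQ]

/-- On `K(u)`, the function `u - c` is a common uniformizer of the places where `u` has the
value `c`. -/
theorem isCommonUniformizer_adjoin_simple {𝒱 : Set (Place K F)} {u : F} {c : K}
    (h0 : u - algebraMap K F c ≠ 0) (h𝒱 : ∀ P ∈ 𝒱, P.IsZero (u - algebraMap K F c)) :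
    IsCommonUniformizer 𝒱 (IntermediateField.adjoin K {u} : IntermediateField K F)
      (u - algebraMap K F c) := by
  have poly : ∀ p : Polynomial K, p ≠ 0 → ∃ n : ℕ, ∀ P ∈ 𝒱,
      P.ring.valuation (Polynomial.aeval u p) =
        P.ring.valuation (u - algebraMap K F c) ^ n := by
    intro p hp
    obtain ⟨r, hr, hdvd⟩ := p.exists_eq_pow_rootMultiplicity_mul_and_not_dvd hp c
    refine ⟨p.rootMultiplicity c, fun P hP => ?_⟩
    have hrc : r.eval c ≠ 0 := fun h => hdvd (Polynomial.dvd_iff_isRoot.2 h)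
    have h1 : P.ring.valuation (Polynomial.aeval u r) = 1 := by
      have hlt := Place.isZero_aeval_sub (h𝒱 P hP) r
      have hc1 := P.valuation_algebraMap hrc
      unfold Place.IsZero at hlt
      have := P.ring.valuation.map_add_eq_of_lt_left (hlt.trans_eq hc1.symm)
      rw [add_sub_cancel] at this
      rw [this, hc1]
    conv_lhs => rw [hr]
    simp [h1]
  refine ⟨h0, h𝒱, fun f hf hf0 => ?_⟩
  obtain ⟨r, s, rfl⟩ := (IntermediateField.mem_adjoin_simple_iff K f).1 hf
  have hr : r ≠ 0 := by
    rintro rfl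
    simp at hf0
  have hs : s ≠ 0 := by
    rintro rfl
    simp at hf0
  obtain ⟨m, hm⟩ := poly r hr
  obtain ⟨n, hn⟩ := poly s hs
  refine ⟨m - n, fun P hP => ?_⟩
  have h0' : P.ring.valuation (u - algebraMap K F c) ≠ 0 := by simpa using h0
  rw [map_div₀, hm P hP, hn P hP, zpow_sub₀ h0']
  simp

/-- Total ramification. Let `t ^ e` have the value of `π ^ c` with `c` prime to `e`, so that
`π` and `t` have the values of `τ ^ e` and `τ ^ c` for some `τ`. Then the terms of a sum
`∑ aᵢ tⁱ`, `i < e`, with `aᵢ ∈ E`, have pairwise different values, and the largest one is the value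
of the sum. Hence `τ` is a common uniformizer on the set of these sums. -/
theorem IsCommonUniformizer.of_ramified {𝒱 : Set (Place K F)} {E E' : Set F} {π t τ : F} {e : ℕ}
    {c : ℤ} (h : IsCommonUniformizer 𝒱 E π) (he : e ≠ 0) (hce : IsCoprime c e) (hτ : τ ≠ 0)
    (hπτ : ∀ P ∈ 𝒱, P.ring.valuation π = P.ring.valuation τ ^ e)
    (htτ : ∀ P ∈ 𝒱, P.ring.valuation t = P.ring.valuation τ ^ c)
    (hspan : ∀ f ∈ E', ∃ a : ℕ → F, (∀ i, a i ∈ E) ∧ f = ∑ i ∈ Finset.range e, a i * t ^ i) :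
    IsCommonUniformizer 𝒱 E' τ := by
  classical
  obtain ⟨-, hz, hd⟩ := h
  have hzτ : ∀ P ∈ 𝒱, P.IsZero τ := fun P hP => by
    have := hz P hP
    unfold Place.IsZero at this
    rw [hπτ P hP, pow_lt_one_iff he] at this
    exact this
  refine ⟨hτ, hzτ, fun f hf hf0 => ?_⟩
  obtain ⟨a, haE, rfl⟩ := hspan f hf
  have hk : ∀ i, ∃ k : ℤ, a i ≠ 0 → ∀ P ∈ 𝒱, P.ring.valuation (a i) = P.ring.valuation π ^ k := by
    intro i
    by_cases hi : a i = 0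
    · exact ⟨0, fun h => absurd hi h⟩
    · obtain ⟨k, hk⟩ := hd _ (haE i) hi
      exact ⟨k, fun _ => hk⟩
  choose k hk using hk
  have hterm : ∀ i, a i ≠ 0 → ∀ P ∈ 𝒱,
      P.ring.valuation (a i * t ^ i) = P.ring.valuation τ ^ (e * k i + c * i) := by
    intro i hi P hP
    have hτ' : P.ring.valuation τ ≠ 0 := by simpa using hτ
    rw [map_mul, map_pow, hk i hi P hP, hπτ P hP, htτ P hP, zpow_add₀ hτ', zpow_mul, zpow_mul,
      zpow_natCast, zpow_natCast]
  let S := (Finset.range e).filter (a · ≠ 0)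
  have hsum : ∑ i ∈ Finset.range e, a i * t ^ i = ∑ i ∈ S, a i * t ^ i := by
    refine (Finset.sum_subset (Finset.filter_subset _ _) fun i hi hiS => ?_).symm
    have : a i = 0 := by
      by_contra h
      exact hiS (Finset.mem_filter.2 ⟨hi, h⟩)
    simp [this]
  have hS : S.Nonempty := by
    by_contra h
    rw [hsum, Finset.not_nonempty_iff_eq_empty.1 h, Finset.sum_empty] at hf0
    exact hf0 rfl
  obtain ⟨j, hj, hjmin⟩ := S.exists_min_image (fun i => e * k i + c * i) hS
  -- If the exponents for `i` and `j` agree, then `e` divides `c * (i - j)`, hence `i - j`.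
  have hinj : ∀ i ∈ S, i ≠ j → (e : ℤ) * k j + c * j < e * k i + c * i := by
    intro i hi hij
    refine lt_of_le_of_ne (hjmin i hi) fun heq => hij ?_
    have hdvd : (e : ℤ) ∣ c * ((i : ℤ) - j) := ⟨k j - k i, by linear_combination -heq⟩
    have hdvd' := hce.symm.dvd_of_dvd_mul_left hdvd
    have hi' := Finset.mem_range.1 (Finset.mem_filter.1 hi).1
    have hj' := Finset.mem_range.1 (Finset.mem_filter.1 hj).1
    have := Int.eq_zero_of_abs_lt_dvd hdvd' (by rw [abs_lt]; omega)
    omega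
  refine ⟨e * k j + c * j, fun P hP => ?_⟩
  have haj : a j ≠ 0 := (Finset.mem_filter.1 hj).2
  have hτ' : 0 < P.ring.valuation τ := by simpa [zero_lt_iff] using hτ
  rw [hsum, ← Finset.add_sum_erase S _ hj, ← hterm j haj P hP]
  apply Valuation.map_add_eq_of_lt_left
  refine P.ring.valuation.map_sum_lt ?_ fun i hi => ?_
  · rw [hterm j haj P hP]
    exact zpow_ne_zero _ hτ'.ne'
  · have hiS := Finset.mem_of_mem_erase hi
    rw [hterm j haj P hP, hterm i (Finset.mem_filter.1 hiS).2 P hP]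
    exact zpow_lt_zpow_right_of_lt_one₀ hτ' (hzτ P hP) (hinj i hiS (Finset.ne_of_mem_erase hi))

/-- The uniformizer of a totally ramified extension is obtained from a Bézout relation between
the values of `π` and `t`. -/
theorem IsCommonUniformizer.exists_of_ramified {𝒱 : Set (Place K F)} {E E' : Set F} {π t : F}
    {e : ℕ} {c : ℤ} (h : IsCommonUniformizer 𝒱 E π) (he : e ≠ 0) (hce : IsCoprime c e)
    (ht : t ≠ 0) (htπ : ∀ P ∈ 𝒱, P.ring.valuation t ^ e = P.ring.valuation π ^ c)
    (hspan : ∀ f ∈ E', ∃ a : ℕ → F, (∀ i, a i ∈ E) ∧ f = ∑ i ∈ Finset.range e, a i * t ^ i) :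
    ∃ τ, IsCommonUniformizer 𝒱 E' τ := by
  obtain ⟨α, β, hαβ⟩ := hce
  have key : ∀ P ∈ 𝒱, P.ring.valuation π = P.ring.valuation (t ^ α * π ^ β) ^ e := by
    intro P hP
    have hπ' : P.ring.valuation π ≠ 0 := by simpa using h.1
    rw [map_mul, mul_pow, map_zpow₀, map_zpow₀, ← zpow_natCast (_ ^ α), zpow_comm, zpow_natCast,
      htπ P hP, ← zpow_natCast (_ ^ β), ← zpow_mul, ← zpow_mul, ← zpow_add₀ hπ']
    rw [show c * α + β * e = 1 by linear_combination hαβ, zpow_one]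
  refine ⟨t ^ α * π ^ β, h.of_ramified he ⟨α, β, hαβ⟩
    (mul_ne_zero (zpow_ne_zero _ ht) (zpow_ne_zero _ h.1)) key (fun P hP => ?_) hspan⟩
  have h2 := htπ P hP
  rw [key P hP] at h2
  have : P.ring.valuation t ^ e = (P.ring.valuation (t ^ α * π ^ β) ^ c) ^ e := by
    rw [h2, ← zpow_natCast, ← zpow_natCast, zpow_comm]
  exact (pow_left_inj₀ zero_le zero_le he).1 this

/-- A field generated over `E` by an `e`-th root `t` of an element of `E` is spanned by the powers
of `t` with exponents less than `e`. -/
theorem exists_eq_sum_of_mem_adjoin_root (E : IntermediateField K F) {t : F} {e : ℕ} (he : e ≠ 0)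
    (hte : t ^ e ∈ E) {f : F} (hf : f ∈ IntermediateField.adjoin E {t}) :
    ∃ a : ℕ → F, (∀ i, a i ∈ (E : Set F)) ∧ f = ∑ i ∈ Finset.range e, a i * t ^ i := by
  let p : Polynomial E := Polynomial.X ^ e - Polynomial.C ⟨t ^ e, hte⟩
  have hp : p.Monic := Polynomial.monic_X_pow_sub_C _ he
  have hpt : Polynomial.aeval t p = 0 := by
    simp [p, IntermediateField.algebraMap_apply]
  have halg : IsAlgebraic E t := ⟨p, hp.ne_zero, hpt⟩
  rw [← IntermediateField.mem_toSubalgebra,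
    IntermediateField.adjoin_simple_toSubalgebra_of_isAlgebraic halg,
    Algebra.adjoin_singleton_eq_range_aeval] at hf
  obtain ⟨r, rfl⟩ := hf
  have hr : Polynomial.aeval t r = Polynomial.aeval t (r %ₘ p) := by
    conv_lhs => rw [← Polynomial.modByMonic_add_div r p]
    simp [hpt]
  refine ⟨fun i => ((r %ₘ p).coeff i : F), fun i => ((r %ₘ p).coeff i).2, ?_⟩
  change Polynomial.aeval t r = _
  rw [hr, Polynomial.aeval_eq_sum_range' (n := e)]
  · simp [Algebra.smul_def, IntermediateField.algebraMap_apply]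
  · have hdeg : p.natDegree = e := Polynomial.natDegree_X_pow_sub_C
    conv_rhs => rw [← hdeg]
    refine Polynomial.natDegree_modByMonic_lt r hp ?_
    intro h1
    rw [h1, Polynomial.natDegree_one] at hdeg
    exact he hdeg.symm

end Ramification

/-! ### Powers of the characteristic -/

/-- `q` is a positive power of the characteristic of `R`, which is a prime. -/
def IsCharPower (R : Type*) [Semiring R] (q : ℕ) : Prop :=
  ∃ p r : ℕ, p.Prime ∧ r ≠ 0 ∧ CharP R p ∧ q = p ^ r

namespace IsCharPower

variable {R : Type*} [CommRing R] {q : ℕ}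

theorem one_lt (h : IsCharPower R q) : 1 < q := by
  obtain ⟨p, r, hp, hr, -, rfl⟩ := h
  exact Nat.one_lt_pow hr hp.one_lt

theorem cast_eq_zero (h : IsCharPower R q) : (q : R) = 0 := by
  obtain ⟨p, r, hp, hr, _, rfl⟩ := h
  simp [hr]

/-- The Frobenius endomorphism `u ↦ u ^ q`. -/
theorem exists_frobenius (h : IsCharPower R q) : ∃ φ : R →+* R, ∀ u, φ u = u ^ q := by
  obtain ⟨p, r, hp, hr, _, rfl⟩ := h
  have : Fact p.Prime := ⟨hp⟩
  exact ⟨iterateFrobenius R p r, iterateFrobenius_def p r⟩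

theorem add_pow (h : IsCharPower R q) (u v : R) : (u + v) ^ q = u ^ q + v ^ q := by
  obtain ⟨φ, hφ⟩ := h.exists_frobenius
  simp only [← hφ, map_add]

theorem sub_pow (h : IsCharPower R q) (u v : R) : (u - v) ^ q = u ^ q - v ^ q := by
  obtain ⟨φ, hφ⟩ := h.exists_frobenius
  simp only [← hφ, map_sub]

theorem neg_pow (h : IsCharPower R q) (u : R) : (-u) ^ q = -u ^ q := by
  obtain ⟨φ, hφ⟩ := h.exists_frobenius
  simp only [← hφ, map_neg]

theorem add_pow_sq (h : IsCharPower R q) (u v : R) :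
    (u + v) ^ (q ^ 2) = u ^ (q ^ 2) + v ^ (q ^ 2) := by
  simp only [sq, pow_mul, h.add_pow]

theorem sub_pow_sq (h : IsCharPower R q) (u v : R) :
    (u - v) ^ (q ^ 2) = u ^ (q ^ 2) - v ^ (q ^ 2) := by
  simp only [sq, pow_mul, h.sub_pow]

theorem of_algebra {K F : Type*} [Field K] [Field F] [Algebra K F] (h : IsCharPower K q) :
    IsCharPower F q := by
  obtain ⟨p, r, hp, hr, _, rfl⟩ := h
  exact ⟨p, r, hp, hr, charP_of_injective_algebraMap (algebraMap K F).injective p, rfl⟩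

end IsCharPower

/-! ### The function field -/

section HermitianIdentities

variable {F : Type*} [Field F] {q : ℕ}

/-- The symmetry between the two coordinates of the Hermitian curve. -/
theorem hermitian_symm (hq : IsCharPower F q) {x y : F} (h : y ^ (q + 1) = x ^ (q + 1) - 1) :
    (x ^ (q ^ 2) - x) * x ^ q = (y ^ (q ^ 2) - y) * y ^ q := by
  have h' : (y ^ (q + 1)) ^ q = (x ^ (q + 1)) ^ q - 1 := by
    rw [h, hq.sub_pow, one_pow]
  linear_combination (exp := 1) h - h'

/-- The right-hand side of the equation of `z`, as `(x ^ q² - x) / y ^ q`. -/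
theorem kummer_rhs_eq {x y : F} (h : y ^ (q + 1) = x ^ (q + 1) - 1) (hy : y ≠ 0) :
    y * ((x ^ (q ^ 2) - x) / (x ^ (q + 1) - 1)) = (x ^ (q ^ 2) - x) / y ^ q := by
  rw [← h]
  field_simp
  ring

/-- A matrix of the unitary group of the form `x ^ (q + 1) - y ^ (q + 1)` with determinant `ζ`
preserves the Hermitian equation. -/
theorem hermitian_transform (hq : IsCharPower F q) {x y a c ζ : F}
    (h : y ^ (q + 1) = x ^ (q + 1) - 1) (ha : a ^ (q ^ 2) = a) (hc : c ^ (q ^ 2) = c)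
    (hac : a ^ (q + 1) - c ^ (q + 1) = 1) (hζ : ζ ^ (q + 1) = 1) :
    (c * x + ζ * a ^ q * y) ^ (q + 1) = (a * x + ζ * c ^ q * y) ^ (q + 1) - 1 := by
  have hc' : (c ^ q) ^ q = c := by rw [← pow_mul, ← sq, hc]
  have ha' : (a ^ q) ^ q = a := by rw [← pow_mul, ← sq, ha]
  rw [pow_succ (_ + _), pow_succ (_ + _), hq.add_pow, hq.add_pow]
  simp only [mul_pow, hc', ha']
  rw [pow_succ] at hζ hac h
  rw [pow_succ] at hac h
  linear_combination (-x ^ q * x + ζ ^ q * ζ * y ^ q * y) * hac + h + (y ^ q * y) * hζ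

/-- Under a unitary matrix of determinant `ζ`, the function `(x ^ q² - x) / y ^ q` is multiplied
by `ζ`. -/
theorem kummer_rhs_transform (hq : IsCharPower F q) {x y a c ζ : F}
    (h : y ^ (q + 1) = x ^ (q + 1) - 1) (ha : a ^ (q ^ 2) = a) (hc : c ^ (q ^ 2) = c)
    (hζ : ζ ^ (q + 1) = 1) :
    ((a * x + ζ * c ^ q * y) ^ (q ^ 2) - (a * x + ζ * c ^ q * y)) * y ^ q =
      ζ * (x ^ (q ^ 2) - x) * (c * x + ζ * a ^ q * y) ^ q := by
  have hζ2 : ζ ^ (q ^ 2) = ζ := by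
    have h1 : ζ ^ (q ^ 2) * ζ ^ (q + 1) = ζ * (ζ ^ (q + 1)) ^ q := by ring
    simpa [hζ] using h1
  have ha' : (a ^ q) ^ q = a := by rw [← pow_mul, ← sq, ha]
  have hc' : (c ^ q) ^ (q ^ 2) = c ^ q := by rw [pow_right_comm, hc]
  have hs := hermitian_symm hq h
  rw [hq.add_pow_sq, hq.add_pow]
  simp only [mul_pow, ha', hc', ha, hζ2]
  rw [pow_succ] at hζ
  linear_combination (-ζ * c ^ q) * hs - a * y ^ q * (x ^ (q ^ 2) - x) * hζ

end HermitianIdentities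

/-- The triple `(x, y, z)` of functions satisfies the two defining equations of the function field,
with `N` for `m / s`, and `x` is not constant. -/
structure IsYTildePoint (K : Type*) {F : Type*} [Field K] [Field F] [Algebra K F] (q N : ℕ)
    (x y z : F) : Prop where
  transc : Transcendental K x
  y_pow : y ^ (q + 1) = x ^ (q + 1) - 1
  z_pow : z ^ N = y * ((x ^ (q ^ 2) - x) / (x ^ (q + 1) - 1))

namespace IsYTildePoint

variable {K F : Type*} [Field K] [Field F] [Algebra K F] {q N : ℕ} {x y z : F}

theorem aeval_ne_zero (h : IsYTildePoint K q N x y z) {p : Polynomial K} (hp : p ≠ 0) :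
    Polynomial.aeval x p ≠ 0 := fun h0 => h.transc ⟨p, hp, h0⟩

theorem sub_algebraMap_ne_zero (h : IsYTildePoint K q N x y z) (c : K) :
    x - algebraMap K F c ≠ 0 := by
  simpa using h.aeval_ne_zero (Polynomial.X_sub_C_ne_zero c)

theorem x_ne_zero (h : IsYTildePoint K q N x y z) : x ≠ 0 := by
  simpa using h.sub_algebraMap_ne_zero 0

theorem pow_sub_ne_zero (h : IsYTildePoint K q N x y z) {n : ℕ} (hn : n ≠ 0) (c : K) :
    x ^ n - algebraMap K F c ≠ 0 := by
  simpa using h.aeval_ne_zero (Polynomial.X_pow_sub_C_ne_zero (Nat.pos_of_ne_zero hn) c)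

theorem y_ne_zero (h : IsYTildePoint K q N x y z) : y ≠ 0 := by
  intro h0
  have := h.pow_sub_ne_zero q.succ_ne_zero 1
  rw [map_one, Nat.succ_eq_add_one, ← h.y_pow, h0] at this
  simp at this

theorem x_pow_sq_sub_ne_zero (h : IsYTildePoint K q N x y z) (hq : 1 < q) :
    x ^ (q ^ 2) - x ≠ 0 := by
  have hX : (Polynomial.X ^ (q ^ 2) - Polynomial.X : Polynomial K) ≠ 0 :=
    FiniteField.X_pow_card_sub_X_ne_zero K (Nat.one_lt_pow two_ne_zero hq)
  simpa using h.aeval_ne_zero hX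

theorem z_pow' (h : IsYTildePoint K q N x y z) : z ^ N = (x ^ (q ^ 2) - x) / y ^ q := by
  rw [h.z_pow, kummer_rhs_eq h.y_pow h.y_ne_zero]

theorem z_ne_zero (h : IsYTildePoint K q N x y z) (hq : 1 < q) (hN : N ≠ 0) : z ≠ 0 := by
  rintro rfl
  have := h.z_pow'
  rw [zero_pow hN] at this
  exact div_ne_zero (h.x_pow_sq_sub_ne_zero hq) (pow_ne_zero _ h.y_ne_zero) this.symm

/-- No nontrivial linear combination of `x` and `y` is zero. -/
theorem linearCombination_eq_zero (h : IsYTildePoint K q N x y z) {a b : K}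
    (hab : algebraMap K F a * x + algebraMap K F b * y = 0) : a = 0 ∧ b = 0 := by
  by_cases hb : b = 0
  · subst hb
    have := h.x_ne_zero
    simpa [this] using hab
  exfalso
  have hb' : algebraMap K F b ≠ 0 := by simpa using hb
  have hy : y = algebraMap K F (-a / b) * x := by
    rw [map_div₀, map_neg]
    field_simp
    linear_combination hab
  have h1 := h.y_pow
  rw [hy, mul_pow, ← map_pow] at h1
  have hne : (Polynomial.C ((-a / b) ^ (q + 1)) * Polynomial.X ^ (q + 1) -
      (Polynomial.X ^ (q + 1) - 1) : Polynomial K) ≠ 0 := by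
    intro h0
    have := congrArg (Polynomial.eval 0) h0
    simp at this
  refine h.aeval_ne_zero hne ?_
  rw [map_sub, map_mul, Polynomial.aeval_C, Polynomial.aeval_X_pow, h1]
  simp

/-- If `(u, v)` spans the same space of functions as `(x, y)`, then `u` is not constant. -/
theorem transcendental_of_span (h : IsYTildePoint K q N x y z) {u v : F} {a b : K}
    (huv : v ^ (q + 1) = u ^ (q + 1) - 1)
    (hx : x = algebraMap K F a * u + algebraMap K F b * v) : Transcendental K u := by
  intro hu
  refine h.transc ?_
  have hv : IsAlgebraic K v :=
    IsAlgebraic.of_pow q.succ_pos (huv ▸ (hu.pow _).sub isAlgebraic_one)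
  rw [hx]
  exact ((isAlgebraic_algebraMap a).mul hu).add ((isAlgebraic_algebraMap b).mul hv)

/-- The image of a solution under a unitary matrix with determinant `ζ` and the multiplication of
`z` by a root `ξ` of `ζ`. -/
theorem transform (h : IsYTildePoint K q N x y z) (hq : IsCharPower K q) {a c ξ : K}
    (ha : a ^ (q ^ 2) = a) (hc : c ^ (q ^ 2) = c) (hac : a ^ (q + 1) - c ^ (q + 1) = 1)
    (hξ : (ξ ^ N) ^ (q + 1) = 1) :
    IsYTildePoint K q N (algebraMap K F a * x + algebraMap K F (ξ ^ N * c ^ q) * y)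
      (algebraMap K F c * x + algebraMap K F (ξ ^ N * a ^ q) * y) (algebraMap K F ξ * z) := by
  have hqF : IsCharPower F q := hq.of_algebra
  have ha' : (algebraMap K F a) ^ (q ^ 2) = algebraMap K F a := by rw [← map_pow, ha]
  have hc' : (algebraMap K F c) ^ (q ^ 2) = algebraMap K F c := by rw [← map_pow, hc]
  have hac' : (algebraMap K F a) ^ (q + 1) - (algebraMap K F c) ^ (q + 1) = 1 := by
    rw [← map_pow, ← map_pow, ← map_sub, hac, map_one]
  have hξ' : ((algebraMap K F ξ) ^ N) ^ (q + 1) = 1 := by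
    rw [← map_pow, ← map_pow, hξ, map_one]
  have h1 := hermitian_transform hqF h.y_pow ha' hc' hac' hξ'
  have h2 := kummer_rhs_transform hqF h.y_pow ha' hc' hξ'
  have hζ0 : ξ ^ N ≠ 0 := by
    intro h0
    simp [h0] at hξ
  simp only [map_mul, map_pow]
  have htr : Transcendental K
      (algebraMap K F a * x + algebraMap K F ξ ^ N * algebraMap K F c ^ q * y) := by
    refine h.transcendental_of_span (a := a ^ q) (b := - c ^ q) h1 ?_
    simp only [map_pow, map_neg]
    rw [pow_succ, pow_succ] at hac'
    linear_combination -x * hac'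
  have hv0 : algebraMap K F c * x + algebraMap K F ξ ^ N * algebraMap K F a ^ q * y ≠ 0 := by
    intro h0
    have h0' : algebraMap K F c * x + algebraMap K F (ξ ^ N * a ^ q) * y = 0 := by
      simpa only [map_mul, map_pow] using h0
    obtain ⟨hc0, ha0⟩ := h.linearCombination_eq_zero h0'
    have ha0' : a = 0 := by
      have := (mul_eq_zero.1 ha0).resolve_left hζ0
      exact pow_eq_zero_iff (by have := hq.one_lt; omega) |>.1 this
    simp [hc0, ha0'] at hac
  refine ⟨htr, h1, ?_⟩
  rw [kummer_rhs_eq h1 hv0, mul_pow, h.z_pow', eq_div_iff (pow_ne_zero _ hv0)]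
  have hy := pow_ne_zero q h.y_ne_zero
  field_simp
  linear_combination -h2

end IsYTildePoint

/-- The polynomial `(X ^ q² - X) / (X ^ (q + 1) - 1)`. -/
theorem exists_mul_eq_X_pow_sub_X (K : Type*) [Field K] {q : ℕ} (hq : 1 < q) :
    ∃ D : Polynomial K,
      D * (Polynomial.X ^ (q + 1) - 1) = Polynomial.X ^ (q ^ 2) - Polynomial.X := by
  obtain ⟨r, rfl⟩ : ∃ r, q = r + 1 := ⟨q - 1, by omega⟩
  obtain ⟨E, hE⟩ : (Polynomial.X ^ (r + 1 + 1) - 1 : Polynomial K) ∣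
      (Polynomial.X ^ (r + 1 + 1)) ^ r - 1 := sub_one_dvd_pow_sub_one _ _
  refine ⟨Polynomial.X * E, ?_⟩
  have hexp : (Polynomial.X ^ ((r + 1) ^ 2) : Polynomial K) =
      Polynomial.X * (Polynomial.X ^ (r + 1 + 1)) ^ r := by
    rw [← pow_mul, ← pow_succ']
    congr 1
    ring
  rw [hexp]
  linear_combination -Polynomial.X * hE

/-- The Eisenstein criterion at `X - 1` for the equation of `z` over `K(x)`. -/
theorem irreducible_kummer {K : Type*} [Field K] {q e : ℕ} (hq : IsCharPower K q) (he : e ≠ 0)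
    {D : Polynomial K}
    (hD : D * (Polynomial.X ^ (q + 1) - 1) = Polynomial.X ^ (q ^ 2) - Polynomial.X) :
    Irreducible (Polynomial.X ^ e - Polynomial.C (algebraMap (Polynomial K) (RatFunc K)
      (D ^ (q + 1) * (Polynomial.X ^ (q + 1) - 1)))) := by
  set R : Polynomial K := D ^ (q + 1) * (Polynomial.X ^ (q + 1) - 1) with hR
  have hmonic : (Polynomial.X ^ e - Polynomial.C R).Monic := Polynomial.monic_X_pow_sub_C _ he
  have hmap : Polynomial.map (algebraMap (Polynomial K) (RatFunc K))
      (Polynomial.X ^ e - Polynomial.C R) =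
      Polynomial.X ^ e - Polynomial.C (algebraMap (Polynomial K) (RatFunc K) R) := by simp
  rw [← hmap, ← hmonic.irreducible_iff_irreducible_map_fraction_map]
  have hprime : Prime (Polynomial.X - Polynomial.C (1 : K)) := Polynomial.prime_X_sub_C 1
  -- Differentiate the equation of `D` at `1`, where `X ^ (q + 1) - 1` has derivative `1`.
  have hD1 : D.eval 1 = -1 := by
    have := congrArg (fun p => Polynomial.eval 1 (Polynomial.derivative p)) hD
    simpa [Polynomial.derivative_mul, Polynomial.derivative_X_pow, hq.cast_eq_zero] using this
  have hR1 : (Polynomial.derivative R).eval 1 ≠ 0 := by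
    simp [hR, Polynomial.derivative_mul, hq.cast_eq_zero, hD1]
  have hdeg : (Polynomial.X ^ e - Polynomial.C R).degree = (e : WithBot ℕ) :=
    Polynomial.degree_X_pow_sub_C (Nat.pos_of_ne_zero he) _
  refine Polynomial.irreducible_of_eisenstein_criterion
    ((Ideal.span_singleton_prime hprime.ne_zero).2 hprime) ?_ ?_ ?_ ?_ hmonic.isPrimitive
  · rw [hmonic.leadingCoeff, Ideal.mem_span_singleton]
    exact fun h => hprime.not_isUnit (isUnit_of_dvd_one h)
  · intro n hn
    rw [hdeg, Nat.cast_lt] at hn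
    rw [Ideal.mem_span_singleton, Polynomial.coeff_sub, Polynomial.coeff_X_pow, if_neg hn.ne,
      Polynomial.coeff_C]
    split_ifs
    · rw [zero_sub, dvd_neg, Polynomial.dvd_iff_isRoot]
      simp [hR]
    · simp
  · rw [hdeg]
    exact_mod_cast Nat.pos_of_ne_zero he
  · rw [Ideal.span_singleton_pow, Ideal.mem_span_singleton]
    simp only [Polynomial.coeff_sub, Polynomial.coeff_X_pow, he.symm, if_false,
      Polynomial.coeff_C_zero, zero_sub, dvd_neg]
    rintro ⟨S, hS⟩
    refine hR1 ?_
    rw [hS]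
    simp [Polynomial.derivative_mul, Polynomial.derivative_pow]

section Lift

variable {K F : Type*} [Field K] [Field F] [Algebra K F] {q N : ℕ} {x y z : F}

/-- Every solution of the defining equations is the image of the universal one, which lives in
`K(X)[T] / (T ^ (N * (q + 1)) - R(X))`. -/
theorem IsYTildePoint.exists_algHom_adjoinRoot (h : IsYTildePoint K q N x y z) {D : Polynomial K}
    (hq : 1 < q)
    (hD : D * (Polynomial.X ^ (q + 1) - 1) = Polynomial.X ^ (q ^ 2) - Polynomial.X) :
    ∃ i : AdjoinRoot (Polynomial.X ^ (N * (q + 1)) - Polynomial.C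
        (algebraMap (Polynomial K) (RatFunc K)
          (D ^ (q + 1) * (Polynomial.X ^ (q + 1) - 1)))) →ₐ[K] F,
      i (AdjoinRoot.of _ RatFunc.X) = x ∧
      i (AdjoinRoot.root _ ^ N * AdjoinRoot.of _ (algebraMap (Polynomial K) (RatFunc K) D)⁻¹) = y ∧
      i (AdjoinRoot.root _) = z := by
  have hinj : Function.Injective (Polynomial.aeval (R := K) x) :=
    transcendental_iff_injective.1 h.transc
  let j : RatFunc K →ₐ[K] F := IsFractionRing.liftAlgHom hinj
  have hj : ∀ p : Polynomial K, j (algebraMap (Polynomial K) (RatFunc K) p) =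
      Polynomial.aeval x p := fun p => IsFractionRing.lift_algebraMap hinj p
  have hden : x ^ (q + 1) - 1 ≠ 0 := by
    simpa using h.pow_sub_ne_zero q.succ_ne_zero 1
  have hDx : Polynomial.aeval x D * (x ^ (q + 1) - 1) = x ^ (q ^ 2) - x := by
    simpa using congrArg (Polynomial.aeval x) hD
  have hz : z ^ N = y * Polynomial.aeval x D := by
    rw [h.z_pow, ← hDx, mul_div_cancel_right₀ _ hden]
  have hD0 : Polynomial.aeval x D ≠ 0 := by
    intro h0
    rw [h0, zero_mul] at hDx
    exact h.x_pow_sq_sub_ne_zero hq hDx.symm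
  have hroot : Polynomial.eval₂ (j : RatFunc K →+* F) z (Polynomial.X ^ (N * (q + 1)) -
      Polynomial.C (algebraMap (Polynomial K) (RatFunc K)
        (D ^ (q + 1) * (Polynomial.X ^ (q + 1) - 1)))) = 0 := by
    rw [Polynomial.eval₂_sub, Polynomial.eval₂_X_pow, Polynomial.eval₂_C, RingHom.coe_coe, hj,
      pow_mul, hz, mul_pow, h.y_pow]
    simp
    ring
  refine ⟨AdjoinRoot.liftAlgHom _ j z hroot, ?_, ?_, ?_⟩
  · rw [AdjoinRoot.liftAlgHom_of, ← RatFunc.algebraMap_X, hj, Polynomial.aeval_X]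
  · rw [map_mul, map_pow, AdjoinRoot.liftAlgHom_of, AdjoinRoot.liftAlgHom_root, map_inv₀, hj, hz,
      mul_inv_cancel_right₀ hD0]
  · rw [AdjoinRoot.liftAlgHom_root]

/-- The field `K(x, y, z)` is `K(x)[T] / (T ^ (N * (q + 1)) - R(x))`, so that it maps to any field
in which the defining equations have a nonconstant solution. -/
theorem IsYTildePoint.exists_algHom {L : Type*} [Field L] [Algebra K L]
    (h : IsYTildePoint K q N x y z) (htop : IntermediateField.adjoin K {x, y, z} = ⊤)
    (hq : IsCharPower K q) (hN : N ≠ 0) {u v w : L} (h' : IsYTildePoint K q N u v w) :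
    ∃ σ : F →ₐ[K] L, σ x = u ∧ σ y = v ∧ σ z = w := by
  obtain ⟨D, hD⟩ := exists_mul_eq_X_pow_sub_X K hq.one_lt
  have : Fact (Irreducible (Polynomial.X ^ (N * (q + 1)) - Polynomial.C
      (algebraMap (Polynomial K) (RatFunc K) (D ^ (q + 1) * (Polynomial.X ^ (q + 1) - 1))))) :=
    ⟨irreducible_kummer hq (Nat.mul_ne_zero hN q.succ_ne_zero) hD⟩
  obtain ⟨i, hx, hy, hz⟩ := h.exists_algHom_adjoinRoot hq.one_lt hD
  obtain ⟨i', hu, hv, hw⟩ := h'.exists_algHom_adjoinRoot hq.one_lt hD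
  have hsurj : i.fieldRange = ⊤ := by
    rw [eq_top_iff, ← htop, IntermediateField.adjoin_le_iff]
    rintro f (rfl | rfl | rfl)
    · exact ⟨_, hx⟩
    · exact ⟨_, hy⟩
    · exact ⟨_, hz⟩
  let E := AlgEquiv.ofBijective i ⟨i.toRingHom.injective, AlgHom.fieldRange_eq_top.1 hsurj⟩
  have hE : ∀ a, E.symm (i a) = a := fun a => E.symm_apply_apply a
  refine ⟨i'.comp E.symm.toAlgHom, ?_, ?_, ?_⟩
  · rw [← hx, ← hu]
    exact congrArg i' (hE _)
  · rw [← hy, ← hv]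
    exact congrArg i' (hE _)
  · rw [← hz, ← hw]
    exact congrArg i' (hE _)

end Lift

/-! ### The group of matrices and roots -/

section LiftGroup

variable {K : Type*} [Field K] {q : ℕ}

/-- The pairs `(A, ξ)`, where `A = !![a, c; ζ c^q, ζ a^q]` is unitary with determinant
`ζ = ξ ^ N`. These are the transposes of the matrices of the substitutions of `(x, y)`, so that
the substitutions compose like the matrices. -/
def liftGroup (hq : IsCharPower K q) (N : ℕ) : Subgroup (GL (Fin 2) K × Kˣ) where
  carrier := {h | ∃ a c : K, a ^ (q ^ 2) = a ∧ c ^ (q ^ 2) = c ∧ a ^ (q + 1) - c ^ (q + 1) = 1 ∧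
    ((h.2 : K) ^ N) ^ (q + 1) = 1 ∧
    (h.1 : Matrix (Fin 2) (Fin 2) K) = !![a, c; (h.2 : K) ^ N * c ^ q, (h.2 : K) ^ N * a ^ q]}
  one_mem' := by
    refine ⟨1, 0, by simp, ?_, by simp, by simp, ?_⟩
    · exact zero_pow (pow_ne_zero _ (by have := hq.one_lt; omega))
    · have : q ≠ 0 := by have := hq.one_lt; omega
      simp [Matrix.one_fin_two, this]
  mul_mem' := by
    rintro ⟨A, ξ⟩ ⟨A', ξ'⟩ ⟨a, c, ha, hc, hac, hξ, hA⟩ ⟨a', c', ha', hc', hac', hξ', hA'⟩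
    dsimp only at *
    set ζ : K := (ξ : K) ^ N
    set ζ' : K := (ξ' : K) ^ N
    have e1 : ∀ u : K, u ^ (q ^ 2) = u → (u ^ q) ^ q = u := fun u h => by rw [← pow_mul, ← sq, h]
    have e2 : ∀ u : K, u ^ (q ^ 2) = u → (u ^ q) ^ (q ^ 2) = u ^ q := fun u h => by
      rw [pow_right_comm, h]
    have hζ2 : ζ' ^ (q ^ 2) = ζ' := by
      have h1 : ζ' ^ (q ^ 2) * ζ' ^ (q + 1) = ζ' * (ζ' ^ (q + 1)) ^ q := by ring
      simpa [hξ'] using h1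
    refine ⟨a * a' + c * (ζ' * c' ^ q), a * c' + c * (ζ' * a' ^ q), ?_, ?_, ?_, ?_, ?_⟩
    · rw [hq.add_pow_sq]
      simp only [mul_pow, e2 _ hc', hζ2, ha, ha', hc]
    · rw [hq.add_pow_sq]
      simp only [mul_pow, e2 _ ha', hζ2, ha, hc', hc]
    · rw [pow_succ] at hac hac' hξ'
      rw [pow_succ] at hac hac'
      rw [pow_succ (_ + _), pow_succ (_ + _), hq.add_pow, hq.add_pow]
      simp only [mul_pow, e1 _ ha', e1 _ hc']
      linear_combination (a ^ q * a - c ^ q * c) * hac' + hac -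
        (c ^ q * c) * (a' ^ q * a' - c' ^ q * c') * hξ'
    · simp only [Prod.mk_mul_mk, Units.val_mul, mul_pow] at hξ hξ' ⊢
      rw [hξ, hξ', one_mul]
    · simp only [Prod.mk_mul_mk, Units.val_mul, mul_pow, hA, hA']
      rw [Matrix.mul_fin_two, hq.add_pow, hq.add_pow]
      simp only [mul_pow, e1 _ ha', e1 _ hc']
      rw [pow_succ] at hξ'
      congr 1
      ext i j
      fin_cases i <;> fin_cases j
      · rfl
      · rfl
      · simp
        linear_combination (-ζ * c ^ q * a') * hξ'
      · simp
        linear_combination (-ζ * c ^ q * c') * hξ'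
  inv_mem' := by
    rintro ⟨A, ξ⟩ ⟨a, c, ha, hc, hac, hξ, hA⟩
    dsimp only at *
    have e1 : ∀ u : K, u ^ (q ^ 2) = u → (u ^ q) ^ q = u := fun u h => by rw [← pow_mul, ← sq, h]
    have e2 : ∀ u : K, u ^ (q ^ 2) = u → (u ^ q) ^ (q ^ 2) = u ^ q := fun u h => by
      rw [pow_right_comm, h]
    set ζ : K := (ξ : K) ^ N with hζdef
    have hζ0 : ζ ≠ 0 := pow_ne_zero _ ξ.ne_zero
    have hζ2 : ζ ^ (q ^ 2) = ζ := by
      have h1 : ζ ^ (q ^ 2) * ζ ^ (q + 1) = ζ * (ζ ^ (q + 1)) ^ q := by ring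
      simpa [hξ] using h1
    have hζq : (ζ⁻¹) ^ q = ζ := by
      rw [inv_pow]
      rw [pow_succ] at hξ
      exact inv_eq_of_mul_eq_one_right hξ
    refine ⟨a ^ q, -(ζ⁻¹ * c), e2 _ ha, ?_, ?_, ?_, ?_⟩
    · rw [sq, pow_mul, hq.neg_pow, hq.neg_pow, ← pow_mul, ← sq, mul_pow, inv_pow, hζ2, hc]
    · rw [pow_succ, pow_succ, hq.neg_pow, e1 _ ha, mul_pow, hζq]
      rw [pow_succ, pow_succ] at hac
      field_simp
      linear_combination hac
    · simp only [Prod.snd_inv, Units.val_inv_eq_inv_val, inv_pow] at hξ ⊢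
      rw [hξ, inv_one]
    · simp only [Prod.fst_inv, Prod.snd_inv, Units.val_inv_eq_inv_val, inv_pow, ← hζdef]
      rw [hq.neg_pow, mul_pow, hζq, e1 _ ha]
      refine Units.inv_eq_of_mul_eq_one_right (u := A) ?_
      rw [hA, Matrix.mul_fin_two, Matrix.one_fin_two]
      rw [pow_succ, pow_succ] at hac
      ext i j
      fin_cases i <;> fin_cases j
      · simp
        field_simp
        linear_combination hac
      · simp
        field_simp
        ring
      · simp
        field_simp
        ring
      · simp
        field_simp
        linear_combination hac

variable {hq : IsCharPower K q} {N : ℕ}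

/-- The matrix `!![a, c; ξ ^ N * c ^ q, ξ ^ N * a ^ q]` with the root `ξ`, as an element of the
group. -/
theorem exists_liftGroup_of_params {a c ξ : K} (ha : a ^ (q ^ 2) = a) (hc : c ^ (q ^ 2) = c)
    (hac : a ^ (q + 1) - c ^ (q + 1) = 1) (hξ0 : ξ ≠ 0) (hξ : (ξ ^ N) ^ (q + 1) = 1) :
    ∃ h : liftGroup hq N, (h.1.2 : K) = ξ ∧
      (h.1.1 : Matrix (Fin 2) (Fin 2) K) = !![a, c; ξ ^ N * c ^ q, ξ ^ N * a ^ q] := by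
  have hdet : (!![a, c; ξ ^ N * c ^ q, ξ ^ N * a ^ q]).det ≠ 0 := by
    rw [Matrix.det_fin_two_of]
    have : a * (ξ ^ N * a ^ q) - c * (ξ ^ N * c ^ q) = ξ ^ N := by
      linear_combination ξ ^ N * hac
    rw [this]
    exact pow_ne_zero _ hξ0
  exact ⟨⟨(Matrix.GeneralLinearGroup.mkOfDetNeZero _ hdet, Units.mk0 ξ hξ0),
    a, c, ha, hc, hac, hξ, rfl⟩, rfl, rfl⟩

theorem liftGroup_ext {h h' : liftGroup hq N} (h1 : (h.1.2 : K) = h'.1.2)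
    (h2 : (h.1.1 : Matrix (Fin 2) (Fin 2) K) = h'.1.1) : h = h' :=
  Subtype.ext (Prod.ext (Units.ext h2) (Units.ext h1))

end LiftGroup

/-! ### The semidirect product -/

section SemidirectProduct

variable {K : Type*} [Field K] {q : ℕ}

/-- The elements of `K` fixed by the `q`-power map form the subfield of order `q`. -/
theorem mem_range_of_pow_eq {Fq : Type*} [Field Fq] (hFq : Nat.card Fq = q) (hq : 1 < q)
    (ι : Fq →+* K) {u : K} (hu : u ^ q = u) : ∃ a, ι a = u := by
  have : Finite Fq := Nat.finite_of_card_ne_zero (by omega)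
  have := Fintype.ofFinite Fq
  rw [Nat.card_eq_fintype_card] at hFq
  have hsplit : (Polynomial.X ^ q - Polynomial.X : Polynomial Fq).Splits := by
    rw [Polynomial.splits_iff_card_roots, ← hFq, FiniteField.roots_X_pow_card_sub_X,
      FiniteField.X_pow_card_sub_X_natDegree_eq Fq Fintype.one_lt_card]
    rfl
  exact hsplit.mem_range_of_isRoot (i := ι) (FiniteField.X_pow_card_sub_X_ne_zero Fq hq)
    (by simp [hu])

/-- There is an element `θ` of the quadratic extension of the field of order `q` that is not fixed
by the Frobenius. -/
theorem exists_pow_sq_eq_and_pow_ne [IsAlgClosed K] (hq : IsCharPower K q) :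
    ∃ θ : K, θ ^ (q ^ 2) = θ ∧ θ ^ q - θ ≠ 0 := by
  have h1 := hq.one_lt
  obtain ⟨δ, hδ⟩ := IsAlgClosed.exists_pow_nat_eq (-1 : K) (show 0 < q - 1 by omega)
  have hδ0 : δ ≠ 0 := by
    rintro rfl
    rw [zero_pow (by omega)] at hδ
    simp at hδ
  have hδq : δ ^ q = -δ := by
    rw [show q = q - 1 + 1 by omega, pow_succ, hδ, neg_one_mul]
  have hdeg : (Polynomial.X ^ q - Polynomial.X - Polynomial.C δ : Polynomial K).degree ≠ 0 := by
    rw [Polynomial.degree_sub_C]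
    · rw [Polynomial.degree_eq_natDegree (FiniteField.X_pow_card_sub_X_ne_zero K h1),
        FiniteField.X_pow_card_sub_X_natDegree_eq K h1]
      exact_mod_cast (by omega : q ≠ 0)
    · rw [Polynomial.degree_eq_natDegree (FiniteField.X_pow_card_sub_X_ne_zero K h1),
        FiniteField.X_pow_card_sub_X_natDegree_eq K h1]
      exact_mod_cast (by omega : 0 < q)
  obtain ⟨θ, hθ⟩ := IsAlgClosed.exists_root _ hdeg
  have hθ' : θ ^ q = θ + δ := by
    simp only [Polynomial.IsRoot.def, Polynomial.eval_sub, Polynomial.eval_pow, Polynomial.eval_X,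
      Polynomial.eval_C] at hθ
    linear_combination hθ
  refine ⟨θ, ?_, ?_⟩
  · rw [sq, pow_mul, hθ', hq.add_pow, hθ', hδq]
    ring
  · rw [hθ']
    simpa using hδ0

/-- Let `P` have the rows `(1, θ)` and `(1, θ ^ q)`. If `A P = P M` and `M` has determinant `1`,
then the entries of `M` are fixed by the Frobenius exactly if `A` is unitary. This is because the
Frobenius interchanges the rows of `P`. -/
theorem unitary_iff_fixed (hq : IsCharPower K q) {θ : K} (hθ : θ ^ (q ^ 2) = θ)
    (hθ' : θ ^ q - θ ≠ 0) {A M : Matrix (Fin 2) (Fin 2) K}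
    (h : A * !![1, θ; 1, θ ^ q] = !![1, θ; 1, θ ^ q] * M) :
    (∀ i j, M i j ^ q = M i j) ↔
      A 0 0 ^ q = A 1 1 ∧ A 0 1 ^ q = A 1 0 ∧ A 1 0 ^ q = A 0 1 ∧ A 1 1 ^ q = A 0 0 := by
  obtain ⟨φ, hφ⟩ := hq.exists_frobenius
  simp only [← hφ] at hθ' h ⊢
  have hθ2 : φ (φ θ) = θ := by
    rw [hφ, hφ, ← pow_mul, ← sq, hθ]
  rw [Matrix.eta_fin_two A, Matrix.eta_fin_two M, Matrix.mul_fin_two, Matrix.mul_fin_two] at h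
  have h00 := congrFun (congrFun h 0) 0
  have h01 := congrFun (congrFun h 0) 1
  have h10 := congrFun (congrFun h 1) 0
  have h11 := congrFun (congrFun h 1) 1
  simp at h00 h01 h10 h11
  have g00 := congrArg φ h00
  have g01 := congrArg φ h01
  have g10 := congrArg φ h10
  have g11 := congrArg φ h11
  simp only [map_add, map_mul, hθ2] at g00 g01 g10 g11
  constructor
  · intro hM
    simp only [hM] at g00 g01 g10 g11
    have a1 : φ (A 0 0) = A 1 1 := by
      refine mul_left_cancel₀ hθ' ?_
      linear_combination g01 - θ * g00 - h11 + θ * h10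
    have a2 : φ (A 1 1) = A 0 0 := by
      refine mul_left_cancel₀ hθ' ?_
      linear_combination -g11 + φ θ * g10 + h01 - φ θ * h00
    refine ⟨a1, ?_, ?_, a2⟩
    · linear_combination g00 - h10 - a1
    · linear_combination g10 - h00 - a2
  · rintro ⟨a1, a2, a3, a4⟩
    rw [a1, a2] at g00 g01
    rw [a3, a4] at g10 g11
    have m10 : φ (M 1 0) = M 1 0 := by
      refine mul_left_cancel₀ hθ' ?_
      linear_combination -g00 + h10 + g10 - h00
    have m11 : φ (M 1 1) = M 1 1 := by
      refine mul_left_cancel₀ hθ' ?_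
      linear_combination -g01 + h11 + g11 - h01
    intro i j
    fin_cases i <;> fin_cases j
    · change φ (M 0 0) = M 0 0
      linear_combination -g00 + h10 - φ θ * m10
    · change φ (M 0 1) = M 0 1
      linear_combination -g01 + h11 - φ θ * m11
    · exact m10
    · exact m11

variable (K) in
/-- The homomorphism `ζ ↦ !![1, 0; 0, ζ]`. -/
def diagGL : Kˣ →* GL (Fin 2) K where
  toFun u := ⟨!![1, 0; 0, (u : K)], !![1, 0; 0, ((u⁻¹ : Kˣ) : K)],
    by simp [Matrix.one_fin_two],
    by simp [Matrix.one_fin_two]⟩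
  map_one' := Units.ext (by simp [Matrix.one_fin_two])
  map_mul' u v := Units.ext (by simp)

theorem coe_diagGL (u : Kˣ) : (diagGL K u : Matrix (Fin 2) (Fin 2) K) = !![1, 0; 0, (u : K)] := rfl

/-- The group of pairs `(A, ξ)` is the semidirect product of the pairs `(A, 1)`, a conjugate of
`SL(2, q)`, and the pairs `(diag(1, ξ ^ N), ξ)`. -/
theorem nonempty_liftGroup_mulEquiv [IsAlgClosed K] {Fq : Type*} [Field Fq]
    (hFq : Nat.card Fq = q) (ι : Fq →+* K) (hq : IsCharPower K q) {N : ℕ} (hN : (N : K) ≠ 0) :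
    ∃ φ : Multiplicative (ZMod (N * (q + 1))) →* MulAut (Matrix.SpecialLinearGroup (Fin 2) Fq),
      Nonempty (liftGroup hq N ≃* Matrix.SpecialLinearGroup (Fin 2) Fq ⋊[φ]
        Multiplicative (ZMod (N * (q + 1)))) := by
  obtain ⟨θ, hθ, hθ'⟩ := exists_pow_sq_eq_and_pow_ne hq
  have hq0 : q ≠ 0 := by have := hq.one_lt; omega
  have : Finite Fq := Nat.finite_of_card_ne_zero (by omega)
  have := Fintype.ofFinite Fq
  have hι : ∀ a, ι a ^ q = ι a := fun a => by
    rw [← map_pow, ← hFq, Nat.card_eq_fintype_card, FiniteField.pow_card]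
  have hdetP : (!![1, θ; 1, θ ^ q]).det ≠ 0 := by
    simpa [Matrix.det_fin_two_of] using hθ'
  let P : GL (Fin 2) K := Matrix.GeneralLinearGroup.mkOfDetNeZero _ hdetP
  -- The special unitary group is the conjugate of `SL(2, q)` by `P`.
  let toGL : Matrix.SpecialLinearGroup (Fin 2) Fq →* GL (Fin 2) K :=
    (MulAut.conj P).toMonoidHom.comp
      (Matrix.SpecialLinearGroup.toGL.comp (Matrix.SpecialLinearGroup.map ι))
  have htoGL : ∀ S, (toGL S : Matrix (Fin 2) (Fin 2) K) * !![1, θ; 1, θ ^ q] =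
      !![1, θ; 1, θ ^ q] * S.1.map ι := by
    intro S
    have : toGL S * P = P * Matrix.SpecialLinearGroup.toGL (Matrix.SpecialLinearGroup.map ι S) := by
      simp [toGL]
    exact congrArg Units.val this
  have hmem : ∀ S, (toGL.prod 1 : _ →* GL (Fin 2) K × Kˣ) S ∈ liftGroup hq N := by
    intro S
    have h1 := htoGL S
    obtain ⟨a1, a2, a3, a4⟩ := (unitary_iff_fixed hq hθ hθ' h1).1 fun i j => hι _
    have hdet : (toGL S : Matrix (Fin 2) (Fin 2) K).det = 1 := by
      have h2 := congrArg Matrix.det h1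
      rw [Matrix.det_mul, Matrix.det_mul, mul_comm] at h2
      rw [mul_left_cancel₀ hdetP h2]
      have := congrArg ι S.2
      rwa [map_one, RingHom.map_det] at this
    refine ⟨(toGL S).1 0 0, (toGL S).1 0 1, ?_, ?_, ?_, by simp, ?_⟩
    · rw [sq, pow_mul, a1, a4]
    · rw [sq, pow_mul, a2, a3]
    · rw [pow_succ, pow_succ, a1, a2, ← hdet, Matrix.det_fin_two]
      ring
    · simp only [MonoidHom.prod_apply, MonoidHom.one_apply, Units.val_one, one_pow, one_mul, a1, a2]
      exact Matrix.eta_fin_two _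
  let inl : Matrix.SpecialLinearGroup (Fin 2) Fq →* liftGroup hq N :=
    (toGL.prod 1).codRestrict _ hmem
  -- The roots of unity `ξ` form a cyclic group of order `N * (q + 1)`, prime to the characteristic.
  have : NeZero ((N * (q + 1) : ℕ) : K) := ⟨by simpa [hq.cast_eq_zero] using hN⟩
  have : NeZero (N * (q + 1)) := .of_neZero_natCast K
  let η : rootsOfUnity (N * (q + 1)) K ≃* Multiplicative (ZMod (N * (q + 1))) :=
    mulEquivOfCyclicCardEq (by
      rw [HasEnoughRootsOfUnity.natCard_rootsOfUnity, Nat.card_eq_fintype_card,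
        Fintype.card_multiplicative, ZMod.card])
  have hroot : ∀ h : liftGroup hq N, h.1.2 ∈ rootsOfUnity (N * (q + 1)) K := by
    rintro ⟨h, a, c, -, -, -, hξ, -⟩
    rw [mem_rootsOfUnity']
    rw [pow_mul]
    exact hξ
  let root : liftGroup hq N →* rootsOfUnity (N * (q + 1)) K :=
    ((MonoidHom.snd _ _).comp (liftGroup hq N).subtype).codRestrict _ hroot
  -- A diagonal matrix is unitary if its entries are `(q + 1)`-st roots of unity.
  have hmem' : ∀ u : rootsOfUnity (N * (q + 1)) K,
      (((diagGL K).comp (powMonoidHom N)).prod (MonoidHom.id _) : Kˣ →* GL (Fin 2) K × Kˣ) u ∈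
        liftGroup hq N := by
    intro u
    refine ⟨1, 0, by simp, zero_pow (pow_ne_zero _ hq0), by simp, ?_, ?_⟩
    · have := u.2
      rw [mem_rootsOfUnity', pow_mul] at this
      exact this
    · change (diagGL K (u.1 ^ N) : Matrix (Fin 2) (Fin 2) K) = _
      rw [coe_diagGL]
      simp [hq0]
  let sec : rootsOfUnity (N * (q + 1)) K →* liftGroup hq N :=
    ((((diagGL K).comp (powMonoidHom N)).prod (MonoidHom.id _)).comp
      (Subgroup.subtype _)).codRestrict _ hmem'
  have hsec : ∀ u, root (sec u) = u := fun u => rfl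
  have hinj : Function.Injective inl := by
    intro S T hST
    have h1 : toGL S = toGL T := congrArg (fun h => h.1.1) hST
    have h2 := (MulAut.conj P).injective h1
    have h3 := Matrix.SpecialLinearGroup.toGL_injective h2
    refine Subtype.ext ?_
    have h4 : S.1.map ι = T.1.map ι := congrArg Subtype.val h3
    exact Matrix.map_injective ι.injective h4
  have hker : inl.range = (η.toMonoidHom.comp root).ker := by
    ext h
    rw [MonoidHom.mem_range, MonoidHom.mem_ker]
    constructor
    · rintro ⟨S, rfl⟩
      have : root (inl S) = 1 := rfl
      simp [this]
    · intro h1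
      have h2 : root h = 1 := η.injective (by simpa using h1)
      have h3 : h.1.2 = 1 := congrArg Subtype.val h2
      obtain ⟨⟨A, ξ⟩, a, c, ha, hc, hac, hξ, hA⟩ := h
      dsimp only at h3 hA
      subst h3
      simp only [Units.val_one, one_pow, one_mul] at hA
      let M : GL (Fin 2) K := P⁻¹ * A * P
      have hM : (A : Matrix (Fin 2) (Fin 2) K) * !![1, θ; 1, θ ^ q] = !![1, θ; 1, θ ^ q] * M := by
        have : A * P = P * M := by simp [M, mul_assoc]
        exact congrArg Units.val this
      have hfix := (unitary_iff_fixed hq hθ hθ' hM).2 (by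
        simp [hA, ← pow_mul, ← sq, ha, hc])
      choose S hS using fun i j => mem_range_of_pow_eq hFq hq.one_lt ι (hfix i j)
      have hSM : (Matrix.of S).map ι = M := by
        ext i j
        exact hS i j
      have hdet : (Matrix.of S).det = 1 := by
        apply ι.injective
        rw [RingHom.map_det, map_one]
        change ((Matrix.of S).map ι).det = 1
        have h2 := congrArg Matrix.det hM
        rw [Matrix.det_mul, Matrix.det_mul, mul_comm] at h2
        rw [hSM, ← mul_left_cancel₀ hdetP h2, hA, Matrix.det_fin_two_of]
        linear_combination hac
      refine ⟨⟨Matrix.of S, hdet⟩, ?_⟩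
      have h4 : toGL ⟨Matrix.of S, hdet⟩ = A := by
        refine mul_right_cancel (b := P) (Units.ext ?_)
        refine (htoGL ⟨Matrix.of S, hdet⟩).trans ?_
        rw [hSM]
        exact hM.symm
      exact Subtype.ext (Prod.ext h4 rfl)
  let E : GroupExtension (Matrix.SpecialLinearGroup (Fin 2) Fq) (liftGroup hq N)
      (Multiplicative (ZMod (N * (q + 1)))) :=
    { inl := inl
      rightHom := η.toMonoidHom.comp root
      inl_injective := hinj
      range_inl_eq_ker_rightHom := hker
      rightHom_surjective := fun g => ⟨sec (η.symm g), by simp [hsec]⟩ }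
  let s : E.Splitting :=
    { sec.comp η.symm.toMonoidHom with
      rightInverse_rightHom := fun g => by
        change η (root (sec (η.symm g))) = g
        rw [hsec, η.apply_symm_apply] }
  exact ⟨s.conjAct, ⟨s.semidirectProductMulEquiv.symm⟩⟩

end SemidirectProduct

/-! ### Places of the function field -/

section Values

variable {K F : Type*} [Field K] [Field F] [Algebra K F] {q : ℕ} {P : Place K F} {u : F}

theorem Place.valuation_add_one_of_isZero (h : P.IsZero u) : P.ring.valuation (1 + u) = 1 := by
  have := P.ring.valuation.map_add_eq_of_lt_left (x := 1) (y := u)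
    (by simpa [IsZero] using h)
  simpa using this

theorem Place.valuation_pow_succ_sub_one (hq : IsCharPower F q) (h : P.IsZero (u - 1)) :
    P.ring.valuation (u ^ (q + 1) - 1) = P.ring.valuation (u - 1) := by
  have h1 := hq.one_lt
  have h2 : u ^ (q + 1) - 1 = (u - 1) * (1 + ((u - 1) ^ (q - 1) + (u - 1) ^ q)) := by
    have h3 : (u - 1) ^ q = u ^ q - 1 := by rw [hq.sub_pow, one_pow]
    have h4 : (u - 1) * (u - 1) ^ (q - 1) = (u - 1) ^ q := by
      rw [← pow_succ']
      congr 1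
      omega
    linear_combination -h4 - u * h3
  rw [h2, map_mul, valuation_add_one_of_isZero, mul_one]
  exact ((isZero_pow (by omega)).2 h).add ((isZero_pow (by omega)).2 h)

theorem Place.valuation_pow_sq_sub (hq : IsCharPower F q) (h : P.IsZero (u - 1)) :
    P.ring.valuation (u ^ (q ^ 2) - u) = P.ring.valuation (u - 1) := by
  have h1 : 1 < q ^ 2 := Nat.one_lt_pow two_ne_zero hq.one_lt
  have h2 : u ^ (q ^ 2) - u = -((u - 1) * (1 + -(u - 1) ^ (q ^ 2 - 1))) := by
    have h3 : (u - 1) ^ (q ^ 2) = u ^ (q ^ 2) - 1 := by rw [hq.sub_pow_sq, one_pow]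
    have h4 : (u - 1) * (u - 1) ^ (q ^ 2 - 1) = (u - 1) ^ (q ^ 2) := by
      rw [← pow_succ']
      congr 1
      omega
    linear_combination -h4 - h3
  rw [h2, Valuation.map_neg, map_mul, valuation_add_one_of_isZero, mul_one]
  unfold IsZero
  rw [Valuation.map_neg]
  exact (isZero_pow (by omega)).2 h

theorem Place.valuation_pow_sub_of_isPole {n : ℕ} (hn : 1 < n) (h : P.IsPole u) :
    P.ring.valuation (u ^ n - u) = P.ring.valuation u ^ n := by
  have h1 : 1 < P.ring.valuation u := by
    rw [← not_le, P.ring.valuation_le_one_iff]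
    exact h
  rw [sub_eq_add_neg, Valuation.map_add_eq_of_lt_left, map_pow]
  rw [Valuation.map_neg, map_pow]
  calc P.ring.valuation u = P.ring.valuation u ^ 1 := (pow_one _).symm
    _ < P.ring.valuation u ^ n := pow_lt_pow_right₀ h1 hn

end Values

namespace IsYTildePoint

variable {K F : Type*} [Field K] [Field F] [Algebra K F] {q N : ℕ} {x y z : F}

theorem mem_of_generators (htop : IntermediateField.adjoin K {x, y, z} = ⊤)
    (E : IntermediateField K F) (hx : x ∈ E) (hy : y ∈ E) (hz : z ∈ E) (f : F) : f ∈ E := by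
  have : IntermediateField.adjoin K {x, y, z} ≤ E := by
    rw [IntermediateField.adjoin_le_iff]
    rintro f (rfl | rfl | rfl)
    exacts [hx, hy, hz]
  exact (htop ▸ this) trivial

theorem pow_mem_adjoin_x (h : IsYTildePoint K q N x y z) :
    z ^ (N * (q + 1)) ∈ IntermediateField.adjoin K {x} := by
  have hx : x ∈ IntermediateField.adjoin K {x} := IntermediateField.mem_adjoin_simple_self K x
  have hB : x ^ (q + 1) - 1 ∈ IntermediateField.adjoin K {x} := sub_mem (pow_mem hx _) (one_mem _)
  rw [pow_mul, h.z_pow, mul_pow, h.y_pow]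
  exact mul_mem hB (pow_mem (div_mem (sub_mem (pow_mem hx _) hx) hB) _)

/-- The field `K(x, y, z)` is spanned over `K(x)` by powers of `z`, since `y` is a product of
`z ^ N` and a function in `K(x)`. -/
theorem exists_eq_sum_pow_z (h : IsYTildePoint K q N x y z)
    (htop : IntermediateField.adjoin K {x, y, z} = ⊤) (hq : 1 < q) (hN : N ≠ 0) (f : F) :
    ∃ a : ℕ → F, (∀ i, a i ∈ ((IntermediateField.adjoin K {x} : IntermediateField K F) : Set F)) ∧
      f = ∑ i ∈ Finset.range (N * (q + 1)), a i * z ^ i := by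
  refine exists_eq_sum_of_mem_adjoin_root _ (Nat.mul_ne_zero hN q.succ_ne_zero)
    h.pow_mem_adjoin_x ?_
  have hz : z ∈ IntermediateField.adjoin (IntermediateField.adjoin K {x}) {z} :=
    IntermediateField.mem_adjoin_simple_self _ z
  have hx : x ∈ IntermediateField.adjoin (IntermediateField.adjoin K {x}) {z} :=
    IntermediateField.algebraMap_mem _
      (⟨x, IntermediateField.mem_adjoin_simple_self K x⟩ : IntermediateField.adjoin K {x})
  refine mem_of_generators htop ((IntermediateField.adjoin _ {z}).restrictScalars K) hx ?_ hz f
  have hA := h.x_pow_sq_sub_ne_zero hq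
  have hB : x ^ (q + 1) - 1 ≠ 0 := by simpa using h.pow_sub_ne_zero q.succ_ne_zero 1
  have hy : y = z ^ N * ((x ^ (q + 1) - 1) / (x ^ (q ^ 2) - x)) := by
    rw [h.z_pow]
    field_simp
  rw [hy]
  exact mul_mem (pow_mem hz _)
    (div_mem (sub_mem (pow_mem hx _) (one_mem _)) (sub_mem (pow_mem hx _) hx))

/-- A place that is not a pole of `x` has a value of `x` in `K`: otherwise its valuation ring
contains `K(x)`, hence the integral element `z`, hence everything. -/
theorem exists_x_value [IsAlgClosed K] (h : IsYTildePoint K q N x y z)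
    (htop : IntermediateField.adjoin K {x, y, z} = ⊤) (hq : 1 < q) (hN : N ≠ 0)
    {P : Place K F} (hP : ¬ P.IsPole x) : ∃ a, P.IsZero (x - algebraMap K F a) := by
  by_contra! hcon
  have hxP : x ∈ P.ring := not_not.1 hP
  have hsub : ∀ f ∈ IntermediateField.adjoin K {x}, f ∈ P.ring := by
    intro f hf
    obtain ⟨r, s, rfl⟩ := (IntermediateField.mem_adjoin_simple_iff K f).1 hf
    have haeval : ∀ p : Polynomial K, Polynomial.aeval x p ∈ P.ring := by
      intro p
      rw [Polynomial.aeval_eq_sum_range]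
      refine sum_mem fun i _ => ?_
      rw [Algebra.smul_def]
      exact mul_mem (P.constants_mem _) (pow_mem hxP _)
    rw [div_eq_mul_inv]
    refine mul_mem (haeval r) ?_
    by_cases hs : s = 0
    · simp [hs, zero_mem]
    · have hs1 : ¬ P.IsZero (Polynomial.aeval x s) := by
        intro h0
        obtain ⟨c, -, hc⟩ := Place.exists_root_value hs h0
        exact hcon c hc
      rw [← ValuationSubring.valuation_le_one_iff, map_inv₀]
      exact inv_le_one_of_one_le₀ (not_lt.1 hs1)
  have hz : z ∈ P.ring := by
    have := hsub _ h.pow_mem_adjoin_x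
    rw [← ValuationSubring.valuation_le_one_iff, map_pow,
      pow_le_one_iff_of_nonneg zero_le (Nat.mul_ne_zero hN q.succ_ne_zero)] at this
    exact (P.ring.valuation_le_one_iff _).1 this
  refine P.ne_top (eq_top_iff.2 fun f _ => ?_)
  obtain ⟨a, ha, rfl⟩ := h.exists_eq_sum_pow_z htop hq hN f
  exact sum_mem fun i _ => mul_mem (hsub _ (ha i)) (pow_mem hz _)

theorem exists_y_value [IsAlgClosed K] (h : IsYTildePoint K q N x y z) {P : Place K F} {a : K}
    (hP : P.IsZero (x - algebraMap K F a)) :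
    ∃ b, b ^ (q + 1) = a ^ (q + 1) - 1 ∧ P.IsZero (y - algebraMap K F b) := by
  have h1 := Place.isZero_aeval_sub hP (Polynomial.X ^ (q + 1) - 1)
  have h2 : (Polynomial.X ^ (q + 1) - Polynomial.C (a ^ (q + 1) - 1) : Polynomial K) ≠ 0 :=
    Polynomial.X_pow_sub_C_ne_zero q.succ_pos _
  obtain ⟨b, hb, hb'⟩ := Place.exists_root_value (P := P) (f := y) h2 (by
    simpa [h.y_pow] using h1)
  refine ⟨b, ?_, hb'⟩
  simpa [sub_eq_zero] using hb

/-- There is only one place where `x` has the value `1`: it is totally ramified over `K(x)`, since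
the equation of `z` over `K(x)` shows that the order of `z ^ (N * (q + 1))` at `x = 1` is one. -/
theorem subsingleton_isZero_sub_one (h : IsYTildePoint K q N x y z)
    (htop : IntermediateField.adjoin K {x, y, z} = ⊤) (hq : IsCharPower K q) (hN : N ≠ 0) :
    {P : Place K F | P.IsZero (x - 1)}.Subsingleton := by
  have hqF : IsCharPower F q := hq.of_algebra
  have h0 := h.sub_algebraMap_ne_zero 1
  have hbase : IsCommonUniformizer {P : Place K F | P.IsZero (x - 1)}
      (IntermediateField.adjoin K {x} : IntermediateField K F) (x - algebraMap K F 1) :=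
    isCommonUniformizer_adjoin_simple h0 fun P hP => by simpa using hP
  rw [map_one] at hbase h0
  have hval : ∀ P ∈ {P : Place K F | P.IsZero (x - 1)},
      P.ring.valuation z ^ (N * (q + 1)) = P.ring.valuation (x - 1) ^ (1 : ℤ) := by
    intro P hP
    have hv0 : P.ring.valuation (x - 1) ≠ 0 := by simpa using h0
    rw [pow_mul, ← map_pow, h.z_pow, map_mul, map_div₀, Place.valuation_pow_sq_sub hqF hP,
      Place.valuation_pow_succ_sub_one hqF hP, div_self hv0, mul_one, ← map_pow, h.y_pow,
      Place.valuation_pow_succ_sub_one hqF hP, zpow_one]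
  obtain ⟨τ, hτ⟩ := hbase.exists_of_ramified (E' := Set.univ) (Nat.mul_ne_zero hN q.succ_ne_zero)
    isCoprime_one_left (h.z_ne_zero hq.one_lt hN) hval
    fun f _ => h.exists_eq_sum_pow_z htop hq.one_lt hN f
  exact hτ.subsingleton

/-- There is only one pole of `x` where `y / x` has the value `1`. It is totally ramified over
`K(y / x)`, in two steps: `x⁻¹` is a `(q + 1)`-st root of `1 - (y / x) ^ (q + 1)`, which has a
simple zero, and `z` is an `N`-th root of a function with a pole of order `q ^ 2 - q`, which is
prime to `N`. -/
theorem subsingleton_isPole (h : IsYTildePoint K q N x y z)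
    (htop : IntermediateField.adjoin K {x, y, z} = ⊤) (hq : IsCharPower K q) (hN : N ≠ 0)
    (hcop : N.Coprime (q * (q - 1))) :
    {P : Place K F | P.IsPole x ∧ P.IsZero (y / x - 1)}.Subsingleton := by
  have hqF : IsCharPower F q := hq.of_algebra
  have hq1 := hq.one_lt
  have hx := h.x_ne_zero
  set 𝒱 := {P : Place K F | P.IsPole x ∧ P.IsZero (y / x - 1)}
  have hu0 : y / x - algebraMap K F 1 ≠ 0 := by
    intro h0
    have h1 : algebraMap K F (-1) * x + algebraMap K F 1 * y = 0 := by
      rw [map_one] at h0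
      rw [map_neg, map_one]
      field_simp at h0
      linear_combination h0
    exact one_ne_zero (h.linearCombination_eq_zero h1).2
  have hbase : IsCommonUniformizer 𝒱
      (IntermediateField.adjoin K {y / x} : IntermediateField K F) (y / x - algebraMap K F 1) :=
    isCommonUniformizer_adjoin_simple hu0 fun P hP => by simpa using hP.2
  rw [map_one] at hbase hu0
  have hroot : x⁻¹ ^ (q + 1) = -((y / x) ^ (q + 1) - 1) := by
    rw [div_pow, h.y_pow, sub_div, div_self (pow_ne_zero _ hx), inv_pow, one_div]
    ring
  let E : IntermediateField K F := (IntermediateField.adjoin (IntermediateField.adjoin K {y / x})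
    {x⁻¹}).restrictScalars K
  have hxE : x ∈ E := inv_mem_iff.1
    (IntermediateField.mem_adjoin_simple_self (IntermediateField.adjoin K {y / x}) x⁻¹)
  have huE : y / x ∈ E := IntermediateField.algebraMap_mem _
    (⟨y / x, IntermediateField.mem_adjoin_simple_self K _⟩ : IntermediateField.adjoin K {y / x})
  have hyE : y ∈ E := by
    have := mul_mem huE hxE
    rwa [div_mul_cancel₀ _ hx] at this
  have hE : IsCommonUniformizer 𝒱 (E : Set F) x⁻¹ := by
    refine hbase.of_ramified (e := q + 1) (c := 1) q.succ_ne_zero isCoprime_one_left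
      (inv_ne_zero hx) (fun P hP => ?_) (fun P hP => (zpow_one _).symm)
      fun f hf => exists_eq_sum_of_mem_adjoin_root _ q.succ_ne_zero ?_ hf
    · rw [← map_pow, hroot, Valuation.map_neg, Place.valuation_pow_succ_sub_one hqF hP.2]
    · rw [hroot]
      exact neg_mem (sub_mem (pow_mem (IntermediateField.mem_adjoin_simple_self K _) _)
        (one_mem _))
  have hval : ∀ P ∈ 𝒱, P.ring.valuation z ^ N =
      P.ring.valuation x⁻¹ ^ (-((q * (q - 1) : ℕ) : ℤ)) := by
    intro P hP
    have hv0 : P.ring.valuation x ≠ 0 := by simpa using hx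
    have hxy : P.ring.valuation y = P.ring.valuation x := by
      have h1 := Place.valuation_add_one_of_isZero hP.2
      rw [add_sub_cancel, map_div₀, div_eq_one_iff_eq hv0] at h1
      exact h1
    rw [← map_pow, h.z_pow', map_div₀, map_pow, hxy,
      Place.valuation_pow_sub_of_isPole (Nat.one_lt_pow two_ne_zero hq1) hP.1, map_inv₀,
      zpow_neg, inv_zpow, inv_inv, zpow_natCast, div_eq_iff (pow_ne_zero _ hv0), ← pow_add]
    congr 1
    obtain ⟨r, rfl⟩ : ∃ r, q = r + 1 := ⟨q - 1, by omega⟩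
    simp
    ring
  have hcop' : IsCoprime (-((q * (q - 1) : ℕ) : ℤ)) N :=
    (Nat.isCoprime_iff_coprime.2 hcop.symm).neg_left
  obtain ⟨τ, hτ⟩ := hE.exists_of_ramified (E' := Set.univ) hN hcop' (h.z_ne_zero hq1 hN) hval
    fun f _ => by
      refine exists_eq_sum_of_mem_adjoin_root E hN ?_ ?_
      · rw [h.z_pow']
        exact div_mem (sub_mem (pow_mem hxE _) hxE) (pow_mem hyE _)
      · exact mem_of_generators htop ((IntermediateField.adjoin E {z}).restrictScalars K)
          (IntermediateField.algebraMap_mem _ (⟨x, hxE⟩ : E))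
          (IntermediateField.algebraMap_mem _ (⟨y, hyE⟩ : E))
          (IntermediateField.mem_adjoin_simple_self E z) f
  exact hτ.subsingleton

end IsYTildePoint

/-! ### The group of automorphisms -/

section Action

variable {K F : Type*} [Field K] [Field F] [Algebra K F] {q N : ℕ} {x y z : F}

/-- The automorphism `σ` is the substitution of `(x, y) A` for `(x, y)` and `ξ z` for `z`. -/
structure IsSubstitution (x y z : F) (h : GL (Fin 2) K × Kˣ) (σ : F → F) : Prop where
  map_x : σ x = algebraMap K F (h.1.1 0 0) * x + algebraMap K F (h.1.1 1 0) * y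
  map_y : σ y = algebraMap K F (h.1.1 0 1) * x + algebraMap K F (h.1.1 1 1) * y
  map_z : σ z = algebraMap K F (h.2 : K) * z

theorem algHom_ext_of_generators {σ τ : F →ₐ[K] F}
    (htop : IntermediateField.adjoin K {x, y, z} = ⊤) (hx : σ x = τ x) (hy : σ y = τ y)
    (hz : σ z = τ z) : σ = τ := by
  let E : IntermediateField K F := (AlgHom.equalizer σ τ).toIntermediateField fun f hf => by
    have : σ f = τ f := hf
    change σ f⁻¹ = τ f⁻¹
    rw [map_inv₀, map_inv₀, this]
  exact AlgHom.ext fun f => IsYTildePoint.mem_of_generators htop E hx hy hz f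

theorem IsSubstitution.eq {h : GL (Fin 2) K × Kˣ} {σ τ : F ≃ₐ[K] F}
    (htop : IntermediateField.adjoin K {x, y, z} = ⊤) (hσ : IsSubstitution x y z h σ)
    (hτ : IsSubstitution x y z h τ) : σ = τ := by
  have : (σ : F →ₐ[K] F) = τ := algHom_ext_of_generators htop (hσ.map_x.trans hτ.map_x.symm)
    (hσ.map_y.trans hτ.map_y.symm) (hσ.map_z.trans hτ.map_z.symm)
  exact AlgEquiv.ext fun f => DFunLike.congr_fun this f

namespace IsYTildePoint

/-- The pairs `(A, ξ)` act faithfully on `K(x, y, z)` by substitutions. -/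
theorem exists_action (h : IsYTildePoint K q N x y z)
    (htop : IntermediateField.adjoin K {x, y, z} = ⊤) (hq : IsCharPower K q) (hN : N ≠ 0) :
    ∃ Φ : liftGroup hq N →* (F ≃ₐ[K] F), Function.Injective Φ ∧
      ∀ g : liftGroup hq N, IsSubstitution x y z g.1 (Φ g) := by
  have hex : ∀ g : liftGroup hq N, ∃ σ : F →ₐ[K] F, IsSubstitution x y z g.1 σ := by
    rintro ⟨⟨A, ξ⟩, a, c, ha, hc, hac, hξ, hA⟩
    obtain ⟨σ, h1, h2, h3⟩ := h.exists_algHom htop hq hN (h.transform hq ha hc hac hξ)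
    dsimp only at hA
    refine ⟨σ, ⟨?_, ?_, h3⟩⟩
    · rw [h1, hA]
      rfl
    · rw [h2, hA]
      rfl
  choose Ψ hΨ using hex
  let M : liftGroup hq N →* (F →ₐ[K] F) :=
    { toFun := Ψ
      map_one' := by
        refine algHom_ext_of_generators htop ?_ ?_ ?_
        · rw [(hΨ 1).map_x]
          simp
        · rw [(hΨ 1).map_y]
          simp
        · rw [(hΨ 1).map_z]
          simp
      map_mul' := fun g g' => by
        have h1 := hΨ g
        have h2 := hΨ g'
        have h3 := hΨ (g * g')
        have hmul : ((g * g').1.1 : Matrix (Fin 2) (Fin 2) K) = g.1.1 * g'.1.1 := rfl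
        refine algHom_ext_of_generators htop ?_ ?_ ?_
        · rw [h3.map_x, AlgHom.mul_apply, h2.map_x, map_add, map_mul, map_mul, h1.map_x, h1.map_y,
            hmul, Matrix.mul_apply, Matrix.mul_apply, Fin.sum_univ_two, Fin.sum_univ_two]
          simp only [map_add, map_mul, AlgHom.commutes]
          ring
        · rw [h3.map_y, AlgHom.mul_apply, h2.map_y, map_add, map_mul, map_mul, h1.map_x, h1.map_y,
            hmul, Matrix.mul_apply, Matrix.mul_apply, Fin.sum_univ_two, Fin.sum_univ_two]
          simp only [map_add, map_mul, AlgHom.commutes]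
          ring
        · rw [h3.map_z, AlgHom.mul_apply, h2.map_z, map_mul, h1.map_z]
          have : ((g * g').1.2 : K) = g.1.2 * g'.1.2 := rfl
          rw [this]
          simp only [map_mul, AlgHom.commutes]
          ring }
  let Φ : liftGroup hq N →* (F ≃ₐ[K] F) :=
    (AlgEquiv.algHomUnitsEquiv K F).toMonoidHom.comp M.toHomUnits
  have hΦ : ∀ g f, Φ g f = Ψ g f := fun g f => rfl
  have hsub : ∀ g, IsSubstitution x y z g.1 (Φ g) := fun g => hΨ g
  refine ⟨Φ, ?_, hsub⟩
  intro g g' hg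
  have h1 := hsub g
  have h2 := hsub g'
  rw [← hg] at h2
  have hx := h1.map_x.symm.trans h2.map_x
  have hy := h1.map_y.symm.trans h2.map_y
  have hz := h1.map_z.symm.trans h2.map_z
  have key : ∀ {a b c d : K}, algebraMap K F a * x + algebraMap K F b * y =
      algebraMap K F c * x + algebraMap K F d * y → a = c ∧ b = d := by
    intro a b c d habcd
    have := h.linearCombination_eq_zero (a := a - c) (b := b - d) (by
      rw [map_sub, map_sub]
      linear_combination habcd)
    exact ⟨sub_eq_zero.1 this.1, sub_eq_zero.1 this.2⟩
  have hz' := (algebraMap K F).injective (mul_right_cancel₀ (h.z_ne_zero hq.one_lt hN) hz)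
  refine liftGroup_ext hz' ?_
  ext i j
  fin_cases i <;> fin_cases j
  exacts [(key hx).1, (key hy).1, (key hx).2, (key hy).2]

end IsYTildePoint

end Action

section Orbits

/-- An orbit is short if and only if the stabilizers of its elements are not trivial. -/
theorem card_orbit_ne_card_iff {G X : Type*} [Group G] [Finite G] [MulAction G X] (P : X) :
    Nat.card (MulAction.orbit G P) ≠ Nat.card G ↔ ∃ g : G, g ≠ 1 ∧ g • P = P := by
  have h1 := Subgroup.card_mul_index (MulAction.stabilizer G P)
  rw [MulAction.index_stabilizer, ← Nat.card_coe_set_eq] at h1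
  have h2 : Nat.card (MulAction.orbit G P) ≠ 0 := by
    intro h0
    rw [h0, mul_zero] at h1
    exact Nat.card_pos.ne h1
  have h3 : Nat.card (MulAction.orbit G P) = Nat.card G ↔ MulAction.stabilizer G P = ⊥ := by
    rw [← Subgroup.card_eq_one, ← h1]
    constructor
    · intro h4
      have : 1 * Nat.card (MulAction.orbit G P) = _ := (one_mul _).trans h4
      exact (Nat.eq_of_mul_eq_mul_right (Nat.pos_of_ne_zero h2) this).symm
    · intro h4
      rw [h4, one_mul]
  rw [Ne, h3, Subgroup.eq_bot_iff_forall]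
  push Not
  simp only [MulAction.mem_stabilizer_iff, and_comm]

/-- A nonempty invariant set `S` is an orbit if all its elements can be moved into a set `T` with
at most one element. It is a short orbit if some `g ≠ 1` leaves `T` invariant. -/
theorem orbit_eq_and_mem_shortOrbits {G X : Type*} [Group G] [Finite G] [MulAction G X]
    {S T : Set X} (hne : S.Nonempty) (hinv : ∀ (g : G), ∀ P ∈ S, g • P ∈ S)
    (hmove : ∀ P ∈ S, ∃ g : G, g • P ∈ T) (hT : T.Subsingleton) {g : G} (hg1 : g ≠ 1)
    (hg : ∀ P ∈ T, g • P ∈ T) :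
    (∀ P ∈ S, MulAction.orbit G P = S) ∧ S ∈ shortOrbits G X := by
  have horb : ∀ P ∈ S, MulAction.orbit G P = S := by
    intro P hP
    refine Set.Subset.antisymm ?_ fun Q hQ => ?_
    · rintro _ ⟨g, rfl⟩
      exact hinv g P hP
    · obtain ⟨a, ha⟩ := hmove P hP
      obtain ⟨b, hb⟩ := hmove Q hQ
      refine ⟨b⁻¹ * a, ?_⟩
      change (b⁻¹ * a) • P = Q
      rw [mul_smul, hT ha hb, inv_smul_smul]
  obtain ⟨P, hP⟩ := hne
  obtain ⟨a, ha⟩ := hmove P hP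
  refine ⟨horb, ⟨a • P, (horb _ (hinv a P hP)).symm⟩, ?_⟩
  rw [← horb _ (hinv a P hP), card_orbit_ne_card_iff]
  exact ⟨g, hg1, hT (hg _ ha) ha⟩

end Orbits

/-! ### The two short orbits -/

section ShortOrbits

variable {K F : Type*} [Field K] [Field F] [Algebra K F] {q N : ℕ} {x y z : F}

variable (K) in
/-- The places at the points `(a, b)` of the Hermitian curve with coordinates in the field of order
`q ^ 2`. -/
def rationalPlaces (q : ℕ) (x y : F) : Set (Place K F) :=
  {P | ∃ a b : K, a ^ (q ^ 2) = a ∧ b ^ (q ^ 2) = b ∧ b ^ (q + 1) - a ^ (q + 1) + 1 = 0 ∧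
    P.IsZero (x - algebraMap K F a) ∧ P.IsZero (y - algebraMap K F b)}

theorem Place.value_linearCombination {P : Place K F} {a b : K}
    (ha : P.IsZero (x - algebraMap K F a)) (hb : P.IsZero (y - algebraMap K F b)) (r s : K) :
    P.IsZero (algebraMap K F r * x + algebraMap K F s * y - algebraMap K F (r * a + s * b)) := by
  have := (ha.smul r).add (hb.smul s)
  simp only [map_add, map_mul]
  convert this using 1
  ring

theorem isPole_inv_smul_iff {h : GL (Fin 2) K × Kˣ} {σ : F ≃ₐ[K] F}
    (hσ : IsSubstitution x y z h σ) (P : Place K F) :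
    (σ⁻¹ • P).IsPole x ↔
      P.IsPole (algebraMap K F (h.1.1 0 0) * x + algebraMap K F (h.1.1 1 0) * y) := by
  rw [Place.isPole_smul_iff, inv_inv, hσ.map_x]

/-- A point of the affine Hermitian curve on a line through the origin with coefficients in the
field of order `q ^ 2` has coordinates in this field. -/
theorem hermitian_rational_of_line (hq : IsCharPower K q) {a b r s : K}
    (hab : b ^ (q + 1) = a ^ (q + 1) - 1) (hr : r ^ (q ^ 2) = r) (hs : s ^ (q ^ 2) = s)
    (hrs : r ≠ 0 ∨ s ≠ 0) (h : r * a + s * b = 0) : a ^ (q ^ 2) = a ∧ b ^ (q ^ 2) = b := by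
  -- A point with `u ^ (q + 1)` in the field of order `q` is itself in the field of order `q ^ 2`.
  have key : ∀ u : K, (u ^ (q + 1)) ^ q = u ^ (q + 1) → u ^ (q ^ 2) = u := by
    intro u hu
    by_cases hu0 : u = 0
    · rw [hu0, zero_pow (pow_ne_zero _ (by have := hq.one_lt; omega))]
    · refine mul_right_cancel₀ (pow_ne_zero q hu0) ?_
      rw [← pow_succ', ← hu]
      ring
  have hnorm : ∀ t : K, t ^ (q ^ 2) = t → (t ^ (q + 1)) ^ q = t ^ (q + 1) := by
    intro t ht
    rw [← pow_mul, show (q + 1) * q = q ^ 2 + q by ring, pow_add, ht, pow_succ']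
  by_cases hs0 : s = 0
  · have hr0 : r ≠ 0 := hrs.resolve_right (not_not.2 hs0)
    have ha0 : a = 0 := by simpa [hs0, hr0] using h
    subst ha0
    rw [zero_pow q.succ_ne_zero, zero_sub] at hab
    refine ⟨zero_pow (pow_ne_zero _ (by have := hq.one_lt; omega)), key b ?_⟩
    rw [hab, hq.neg_pow, one_pow]
  · obtain ⟨t, ht, hb⟩ : ∃ t : K, t ^ (q ^ 2) = t ∧ b = t * a := by
      refine ⟨-r / s, ?_, ?_⟩
      · have hneg : (-r) ^ (q ^ 2) = -r := by
          rw [sq, pow_mul, hq.neg_pow, hq.neg_pow, ← pow_mul, ← sq, hr]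
        rw [div_pow, hneg, hs]
      · field_simp
        linear_combination h
    have hw : a ^ (q + 1) * (1 - t ^ (q + 1)) = 1 := by
      rw [hb, mul_pow] at hab
      linear_combination -hab
    have hw' : (a ^ (q + 1)) ^ q * (1 - t ^ (q + 1)) = 1 := by
      have := congrArg (· ^ q) hw
      simpa only [mul_pow, hq.sub_pow, one_pow, hnorm t ht] using this
    have hw0 : 1 - t ^ (q + 1) ≠ 0 := by
      intro h0
      simp [h0] at hw
    have ha : a ^ (q ^ 2) = a := key a (mul_right_cancel₀ hw0 (hw'.trans hw.symm))
    exact ⟨ha, by rw [hb, mul_pow, ha, ht]⟩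

namespace IsYTildePoint

theorem not_isPole_inv_smul [IsAlgClosed K] (h : IsYTildePoint K q N x y z)
    (htop : IntermediateField.adjoin K {x, y, z} = ⊤) (hq : IsCharPower K q) (hN : N ≠ 0)
    {g : GL (Fin 2) K × Kˣ} {σ : F ≃ₐ[K] F} (hσ : IsSubstitution x y z g σ) {P : Place K F}
    (hP : ¬ P.IsPole x) : ¬ (σ⁻¹ • P).IsPole x := by
  obtain ⟨a, ha⟩ := h.exists_x_value htop hq.one_lt hN hP
  obtain ⟨b, -, hb⟩ := h.exists_y_value ha
  rw [isPole_inv_smul_iff hσ]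
  exact not_not.2 (Place.mem_of_sub_isZero (Place.value_linearCombination ha hb _ _))

theorem _root_.liftGroup_entries_pow {hq : IsCharPower K q} (g : liftGroup hq N) (i j : Fin 2) :
    (g.1.1.1 i j) ^ (q ^ 2) = g.1.1.1 i j := by
  obtain ⟨⟨A, ξ⟩, a, c, ha, hc, -, hξ, hA⟩ := g
  have hξ' : ((ξ : K) ^ N) ^ (q ^ 2) = (ξ : K) ^ N := by
    have h1 : ((ξ : K) ^ N) ^ (q ^ 2) * ((ξ : K) ^ N) ^ (q + 1) =
      (ξ : K) ^ N * (((ξ : K) ^ N) ^ (q + 1)) ^ q := by ring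
    simpa [hξ] using h1
  dsimp only at hA ⊢
  rw [hA]
  have e2 : ∀ u : K, u ^ (q ^ 2) = u → (u ^ q) ^ (q ^ 2) = u ^ q := fun u h => by
    rw [pow_right_comm, h]
  fin_cases i <;> fin_cases j
  · exact ha
  · exact hc
  · change ((ξ : K) ^ N * c ^ q) ^ (q ^ 2) = (ξ : K) ^ N * c ^ q
    rw [mul_pow, hξ', e2 c hc]
  · change ((ξ : K) ^ N * a ^ q) ^ (q ^ 2) = (ξ : K) ^ N * a ^ q
    rw [mul_pow, hξ', e2 a ha]

theorem inv_smul_mem_rationalPlaces [IsAlgClosed K] (h : IsYTildePoint K q N x y z)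
    {hq : IsCharPower K q} {g : liftGroup hq N} {σ : F ≃ₐ[K] F}
    (hσ : IsSubstitution x y z g.1 σ) {P : Place K F} (hP : P ∈ rationalPlaces K q x y) :
    σ⁻¹ • P ∈ rationalPlaces K q x y := by
  obtain ⟨a, b, ha, hb, -, hx, hy⟩ := hP
  have hx' : (σ⁻¹ • P).IsZero (x - algebraMap K F (g.1.1.1 0 0 * a + g.1.1.1 1 0 * b)) := by
    rw [Place.isZero_smul_iff, inv_inv, map_sub, AlgEquiv.commutes, hσ.map_x]
    exact Place.value_linearCombination hx hy _ _
  have hy' : (σ⁻¹ • P).IsZero (y - algebraMap K F (g.1.1.1 0 1 * a + g.1.1.1 1 1 * b)) := by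
    rw [Place.isZero_smul_iff, inv_inv, map_sub, AlgEquiv.commutes, hσ.map_y]
    exact Place.value_linearCombination hx hy _ _
  obtain ⟨b', hb', hyb'⟩ := h.exists_y_value hx'
  rw [Place.value_unique hyb' hy'] at hb'
  refine ⟨_, _, ?_, ?_, ?_, hx', hy'⟩
  · rw [hq.add_pow_sq]
    simp only [mul_pow, liftGroup_entries_pow g, ha, hb]
  · rw [hq.add_pow_sq]
    simp only [mul_pow, liftGroup_entries_pow g, ha, hb]
  · rw [hb']
    ring

variable {hq : IsCharPower K q} {Φ : liftGroup hq N →* (F ≃ₐ[K] F)}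

/-- Every pole of `x` can be moved to one where `y / x` has the value `1`, by a substitution
`y ↦ ζ y`. -/
theorem exists_smul_isPole [IsAlgClosed K] (h : IsYTildePoint K q N x y z) (hN : N ≠ 0)
    (hΦ : ∀ g, IsSubstitution x y z g.1 (Φ g)) {P : Place K F} (hP : P.IsPole x) :
    ∃ g, (Φ g • P).IsPole x ∧ (Φ g • P).IsZero (y / x - 1) := by
  have hx := h.x_ne_zero
  have hq0 : q ≠ 0 := by have := hq.one_lt; omega
  obtain ⟨ε, hε, hPε⟩ := Place.exists_root_value (P := P) (f := y / x)
    (p := Polynomial.X ^ (q + 1) - Polynomial.C 1) (Polynomial.X_pow_sub_C_ne_zero q.succ_pos 1) (by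
      have h1 : Polynomial.aeval (y / x) (Polynomial.X ^ (q + 1) - Polynomial.C (1 : K)) =
          -(x⁻¹) ^ (q + 1) := by
        rw [map_sub, Polynomial.aeval_X_pow, Polynomial.aeval_C, map_one, div_pow, h.y_pow, sub_div,
          div_self (pow_ne_zero _ hx), inv_pow, one_div]
        ring
      rw [h1]
      unfold Place.IsZero
      rw [Valuation.map_neg, map_pow, pow_lt_one_iff q.succ_ne_zero, map_inv₀, inv_lt_one₀]
      · rw [← not_le, P.ring.valuation_le_one_iff]
        exact hP
      · simpa [zero_lt_iff] using hx)
  have hε1 : ε ^ (q + 1) = 1 := by simpa [sub_eq_zero] using hε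
  have hε0 : ε ≠ 0 := by
    rintro rfl
    simp at hε1
  obtain ⟨ξ, hξ⟩ := IsAlgClosed.exists_pow_nat_eq ε⁻¹ (Nat.pos_of_ne_zero hN)
  have hξ0 : ξ ≠ 0 := by
    rintro rfl
    rw [zero_pow hN] at hξ
    exact inv_ne_zero hε0 hξ.symm
  obtain ⟨g, -, hg⟩ := exists_liftGroup_of_params (hq := hq) (N := N) (a := 1) (c := 0) (ξ := ξ)
    (by simp) (zero_pow (pow_ne_zero _ hq0)) (by simp) hξ0 (by rw [hξ, inv_pow, hε1, inv_one])
  have hgx := (hΦ g).map_x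
  have hgy := (hΦ g).map_y
  rw [hg, hξ] at hgx hgy
  simp [hq0] at hgx hgy
  refine ⟨g⁻¹, ?_, ?_⟩
  · rw [map_inv, Place.isPole_smul_iff, inv_inv, hgx]
    exact hP
  · rw [map_inv, Place.isZero_smul_iff, inv_inv, map_sub, map_div₀, hgx, hgy, map_one]
    have := hPε.smul ε⁻¹
    convert this using 1
    have hε' : algebraMap K F ε ≠ 0 := by simpa using hε0
    rw [map_inv₀]
    field_simp

/-- The place at a rational point `(a, b)` can be moved to `x = 1`, by a unitary matrix with first
column `(a ^ q, -b ^ q)`. -/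
theorem exists_smul_isZero_sub_one (hΦ : ∀ g, IsSubstitution x y z g.1 (Φ g)) {P : Place K F}
    (hP : P ∈ rationalPlaces K q x y) : ∃ g, (Φ g • P).IsZero (x - 1) := by
  obtain ⟨a, b, ha, hb, hab, hx, hy⟩ := hP
  obtain ⟨g, -, hg⟩ := exists_liftGroup_of_params (hq := hq) (N := N) (a := a ^ q) (c := -b)
    (ξ := 1) (by rw [pow_right_comm, ha])
    (by rw [sq, pow_mul, hq.neg_pow, hq.neg_pow, ← pow_mul, ← sq, hb])
    (by
      rw [pow_succ, pow_succ, hq.neg_pow, ← pow_mul, ← sq, ha]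
      rw [pow_succ, pow_succ] at hab
      linear_combination -hab) one_ne_zero (by simp)
  have hgx := (hΦ g).map_x
  rw [hg] at hgx
  refine ⟨g⁻¹, ?_⟩
  rw [map_inv, Place.isZero_smul_iff, inv_inv, map_sub, hgx, map_one]
  have hv : a ^ q * a + -b ^ q * b = 1 := by
    rw [pow_succ, pow_succ] at hab
    linear_combination -hab
  have := Place.value_linearCombination hx hy (a ^ q) (-b ^ q)
  rw [hv, map_one] at this
  simpa [hq.neg_pow] using this

/-- A substitution that is not the identity and that preserves the condition `x = ∞`,
`y / x = 1`: the unipotent matrix with rows `(1 + κ, κ)` and `(-κ, 1 - κ)`, where `κ ^ q = -κ`. -/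
theorem exists_ne_one_isPole [IsAlgClosed K] (h : IsYTildePoint K q N x y z)
    (hΦ : ∀ g, IsSubstitution x y z g.1 (Φ g)) :
    ∃ g, g ≠ 1 ∧ ∀ P : Place K F, P.IsPole x ∧ P.IsZero (y / x - 1) →
      (Φ g • P).IsPole x ∧ (Φ g • P).IsZero (y / x - 1) := by
  have hq1 := hq.one_lt
  have hx := h.x_ne_zero
  obtain ⟨κ, hκ⟩ := IsAlgClosed.exists_pow_nat_eq (-1 : K) (show 0 < q - 1 by omega)
  have hκ0 : κ ≠ 0 := by
    rintro rfl
    rw [zero_pow (by omega)] at hκ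
    simp at hκ
  have hκq : κ ^ q = -κ := by
    rw [show q = q - 1 + 1 by omega, pow_succ, hκ, neg_one_mul]
  have hκ2 : κ ^ (q ^ 2) = κ := by
    rw [sq, pow_mul, hκq, hq.neg_pow, hκq, neg_neg]
  obtain ⟨g, -, hg⟩ := exists_liftGroup_of_params (hq := hq) (N := N) (a := 1 + κ) (c := κ)
    (ξ := 1) (by rw [hq.add_pow_sq, one_pow, hκ2]) hκ2
    (by
      rw [pow_succ, pow_succ, hq.add_pow, one_pow, hκq]
      ring) one_ne_zero (by simp)
  have hgx := (hΦ g).map_x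
  have hgy := (hΦ g).map_y
  rw [hg] at hgx hgy
  simp [hκq, hq.add_pow] at hgx hgy
  refine ⟨g⁻¹, ?_, fun P hP => ?_⟩
  · rw [Ne, inv_eq_one]
    rintro rfl
    have := congrFun (congrFun hg 0) 1
    simp at this
    exact hκ0 this.symm
  have hunit := Place.valuation_add_one_of_isZero (hP.2.smul (-κ))
  set w := 1 + algebraMap K F (-κ) * (y / x - 1) with hw
  have hw0 : w ≠ 0 := by
    intro h0
    simp [h0] at hunit
  have hgx' : Φ g x = x * w := by
    rw [hgx, hw, map_neg]
    field_simp
    ring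
  constructor
  · rw [map_inv, Place.isPole_smul_iff, inv_inv, hgx']
    unfold Place.IsPole
    rw [← ValuationSubring.valuation_le_one_iff, map_mul, hunit, mul_one,
      ValuationSubring.valuation_le_one_iff]
    exact hP.1
  · rw [map_inv, Place.isZero_smul_iff, inv_inv, map_sub, map_div₀, map_one, hgx', hgy]
    have h1 : (algebraMap K F κ * x + (1 + -algebraMap K F κ) * y) / (x * w) - 1 =
        (y / x - 1) / w := by
      have hwx : x * w = x - algebraMap K F κ * (y - x) := by
        rw [hw, map_neg]
        field_simp
        ring
      rw [div_sub_one (mul_ne_zero hx hw0), div_sub_one hx, div_div, hwx]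
      congr 1
      ring
    rw [h1]
    unfold Place.IsZero
    rw [map_div₀, hunit, div_one]
    exact hP.2

/-- A substitution `z ↦ ξ z` that is not the identity and preserves the condition `x = 1`. -/
theorem exists_ne_one_isZero_sub_one [IsAlgClosed K] (hN : (N : K) ≠ 0)
    (hΦ : ∀ g, IsSubstitution x y z g.1 (Φ g)) :
    ∃ g, g ≠ 1 ∧ ∀ P : Place K F, P.IsZero (x - 1) → (Φ g • P).IsZero (x - 1) := by
  have hq0 : q ≠ 0 := by have := hq.one_lt; omega
  have hN0 : N ≠ 0 := by
    rintro rfl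
    simp at hN
  have : NeZero ((N * (q + 1) : ℕ) : K) := ⟨by simpa [hq.cast_eq_zero] using hN⟩
  obtain ⟨ξ, hξ⟩ := HasEnoughRootsOfUnity.exists_primitiveRoot K (N * (q + 1))
  have hξ1 : ξ ≠ 1 := hξ.ne_one (by nlinarith [hq.one_lt, Nat.pos_of_ne_zero hN0])
  obtain ⟨g, hgξ, hg⟩ := exists_liftGroup_of_params (hq := hq) (N := N) (a := 1) (c := 0) (ξ := ξ)
    (by simp) (zero_pow (pow_ne_zero _ hq0)) (by simp)
    (hξ.ne_zero (Nat.mul_ne_zero hN0 q.succ_ne_zero)) (by rw [← pow_mul, hξ.pow_eq_one])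
  have hgx := (hΦ g).map_x
  rw [hg] at hgx
  simp [hq0] at hgx
  refine ⟨g⁻¹, ?_, fun P hP => ?_⟩
  · rw [Ne, inv_eq_one]
    rintro rfl
    exact hξ1 hgξ.symm
  · rw [map_inv, Place.isZero_smul_iff, inv_inv, map_sub, map_one, hgx]
    exact hP

/-- At a place where `x` has the value `a` and `y` the value `b ≠ 0`, the function `z` has a value,
and this value is not zero unless `a` lies in the field of order `q ^ 2`. -/
theorem exists_z_value [IsAlgClosed K] (h : IsYTildePoint K q N x y z) (hN : N ≠ 0)
    {P : Place K F} {a b : K} (ha : P.IsZero (x - algebraMap K F a))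
    (hb : P.IsZero (y - algebraMap K F b)) (hb0 : b ≠ 0) (ha' : a ^ (q ^ 2) ≠ a) :
    ∃ c, c ≠ 0 ∧ P.IsZero (z - algebraMap K F c) := by
  set w : K := (a ^ (q ^ 2) - a) / b ^ q with hw
  have hw0 : w ≠ 0 := div_ne_zero (sub_ne_zero.2 ha') (pow_ne_zero _ hb0)
  have h1 := Place.isZero_aeval_sub ha (Polynomial.X ^ (q ^ 2) - Polynomial.X)
  have h2 := (Place.isZero_aeval_sub hb (Polynomial.X ^ q)).smul w
  have hy := pow_ne_zero q h.y_ne_zero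
  have h3 : P.IsZero (y ^ q * (z ^ N - algebraMap K F w)) := by
    convert h1.sub h2 using 1
    rw [h.z_pow']
    have hwb : algebraMap K F (w * b ^ q) = algebraMap K F (a ^ (q ^ 2) - a) := by
      rw [hw, div_mul_cancel₀ _ (pow_ne_zero _ hb0)]
    rw [map_mul] at hwb
    simp only [map_sub, map_pow, Polynomial.aeval_X, Polynomial.eval_sub, Polynomial.eval_pow,
      Polynomial.eval_X] at hwb ⊢
    field_simp
    linear_combination -hwb
  have hyv : P.ring.valuation y = 1 := by
    have := P.ring.valuation.map_add_eq_of_lt_left (x := algebraMap K F b)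
      (y := y - algebraMap K F b) (by rw [P.valuation_algebraMap hb0]; exact hb)
    rwa [add_sub_cancel, P.valuation_algebraMap hb0] at this
  have h4 : P.IsZero (z ^ N - algebraMap K F w) := by
    unfold Place.IsZero at h3 ⊢
    rwa [map_mul, map_pow, hyv, one_pow, one_mul] at h3
  obtain ⟨c, hc, hPc⟩ := Place.exists_root_value (P := P) (f := z)
    (Polynomial.X_pow_sub_C_ne_zero (Nat.pos_of_ne_zero hN) w) (by simpa using h4)
  refine ⟨c, ?_, hPc⟩
  rintro rfl
  simp [zero_pow hN] at hc
  exact hw0 hc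

/-- Outside the two exceptional sets the stabilizers are trivial. A matrix that fixes the point
`(a, b)` with `a`, `b` not in the field of order `q ^ 2` is the identity, since its entries are in
this field. Then `ξ` is `1`, since `z` has a nonzero value at the place. -/
theorem eq_one_of_smul_eq [IsAlgClosed K] (h : IsYTildePoint K q N x y z)
    (htop : IntermediateField.adjoin K {x, y, z} = ⊤) (hN : N ≠ 0)
    (hΦ : ∀ g, IsSubstitution x y z g.1 (Φ g)) {P : Place K F} (hP : ¬ P.IsPole x)
    (hP' : P ∉ rationalPlaces K q x y) {g : liftGroup hq N} (hg : Φ g • P = P) : g = 1 := by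
  have hfix : ∀ f, P.IsZero (Φ g f) ↔ P.IsZero f := by
    intro f
    have := Place.isZero_smul_iff (Φ g) P (Φ g f)
    rw [hg] at this
    rw [this, ← AlgEquiv.mul_apply, inv_mul_cancel, AlgEquiv.one_apply]
  obtain ⟨a, ha⟩ := h.exists_x_value htop hq.one_lt hN hP
  obtain ⟨b, hab, hb⟩ := h.exists_y_value ha
  have hrat : ¬ (a ^ (q ^ 2) = a ∧ b ^ (q ^ 2) = b) := fun hrat =>
    hP' ⟨a, b, hrat.1, hrat.2, by rw [hab]; ring, ha, hb⟩
  have hx := (hfix (x - algebraMap K F a)).2 ha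
  rw [map_sub, AlgEquiv.commutes, (hΦ g).map_x] at hx
  have hy := (hfix (y - algebraMap K F b)).2 hb
  rw [map_sub, AlgEquiv.commutes, (hΦ g).map_y] at hy
  have hxv := Place.value_unique (Place.value_linearCombination ha hb _ _) hx
  have hyv := Place.value_unique (Place.value_linearCombination ha hb _ _) hy
  have hA := liftGroup_entries_pow g
  have key : ∀ r s : K, r ^ (q ^ 2) = r → s ^ (q ^ 2) = s → r * a + s * b = 0 → r = 0 ∧ s = 0 := by
    intro r s hr hs hrs
    by_contra hcon
    exact hrat (hermitian_rational_of_line hq hab hr hs (not_and_or.1 hcon) hrs)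
  obtain ⟨h00, h10⟩ := key (g.1.1.1 0 0 - 1) (g.1.1.1 1 0)
    (by rw [hq.sub_pow_sq, one_pow, hA]) (hA _ _) (by linear_combination hxv)
  obtain ⟨h01, h11⟩ := key (g.1.1.1 0 1) (g.1.1.1 1 1 - 1) (hA _ _)
    (by rw [hq.sub_pow_sq, one_pow, hA]) (by linear_combination hyv)
  have hb0 : b ≠ 0 := by
    rintro rfl
    have := key 0 1 (zero_pow (pow_ne_zero _ (by have := hq.one_lt; omega))) (one_pow _) (by simp)
    exact one_ne_zero this.2
  have ha' : a ^ (q ^ 2) ≠ a := by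
    intro ha'
    have h1 : (b ^ (q ^ 2) - b) * b ^ q = 0 := by
      rw [← hermitian_symm hq hab, ha', sub_self, zero_mul]
    have h2 := (mul_eq_zero.1 h1).resolve_right (pow_ne_zero _ hb0)
    exact hrat ⟨ha', sub_eq_zero.1 h2⟩
  obtain ⟨c, hc0, hc⟩ := h.exists_z_value hN ha hb hb0 ha'
  have hz := (hfix (z - algebraMap K F c)).2 hc
  rw [map_sub, AlgEquiv.commutes, (hΦ g).map_z] at hz
  have hz' := hc.smul (g.1.2 : K)
  rw [mul_sub, ← map_mul] at hz'
  have hξ : (g.1.2 : K) = 1 := mul_right_cancel₀ hc0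
    ((Place.value_unique hz' hz).trans (one_mul c).symm)
  refine liftGroup_ext hξ ?_
  ext i j
  fin_cases i <;> fin_cases j
  exacts [sub_eq_zero.1 h00, h01, h10, sub_eq_zero.1 h11]

end IsYTildePoint

end ShortOrbits

section

variable {K F : Type*} [Field K] [Field F] [Algebra K F] {q N : ℕ} {x y z : F}

/-- The short orbits are the set of the poles of `x` and the set of the places at the points with
coordinates in the field of order `q ^ 2`, and these two sets are different. -/
theorem IsYTildePoint.shortOrbits_range [IsAlgClosed K] (h : IsYTildePoint K q N x y z)
    (htop : IntermediateField.adjoin K {x, y, z} = ⊤) {hq : IsCharPower K q} (hN : (N : K) ≠ 0)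
    (hcop : N.Coprime (q * (q - 1))) {Φ : liftGroup hq N →* (F ≃ₐ[K] F)}
    (hinj : Function.Injective Φ) (hΦ : ∀ g, IsSubstitution x y z g.1 (Φ g)) [Finite Φ.range] :
    {P : Place K F | P.IsPole x} ≠ rationalPlaces K q x y ∧
    shortOrbits Φ.range (Place K F) = {{P | P.IsPole x}, rationalPlaces K q x y} := by
  have hN0 : N ≠ 0 := by
    rintro rfl
    simp at hN
  have hx0 := h.x_ne_zero
  have hne : {P : Place K F | P.IsPole x}.Nonempty := by
    have htr : Transcendental K x⁻¹ := fun h0 => h.transc (IsAlgebraic.inv_iff.1 h0)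
    obtain ⟨P, hP⟩ := Place.exists_isZero htr
    refine ⟨P, ?_⟩
    unfold Place.IsZero at hP
    rw [map_inv₀, inv_lt_one₀ (by simpa [zero_lt_iff] using hx0)] at hP
    change x ∉ P.ring
    rw [← P.ring.valuation_le_one_iff, not_le]
    exact hP
  have hne' : (rationalPlaces K q x y).Nonempty := by
    have htr : Transcendental K (x - algebraMap K F 1) := fun h0 => h.transc (by
      have := h0.add (isAlgebraic_algebraMap (A := F) (1 : K))
      rwa [sub_add_cancel] at this)
    obtain ⟨P, hP⟩ := Place.exists_isZero htr
    obtain ⟨b, hb, hb'⟩ := h.exists_y_value hP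
    have hb0 : b = 0 := by simpa using hb
    subst hb0
    refine ⟨P, 1, 0, one_pow _, zero_pow ?_, by simp, hP, hb'⟩
    exact pow_ne_zero _ (by have := hq.one_lt; omega)
  have hdisj : ∀ P ∈ rationalPlaces K q x y, ¬ P.IsPole x := by
    rintro P ⟨a, b, -, -, -, ha, -⟩
    exact not_not.2 (Place.mem_of_sub_isZero ha)
  have hinv : ∀ (g : Φ.range) (P : Place K F), P ∈ {P : Place K F | P.IsPole x} →
      g • P ∈ {P : Place K F | P.IsPole x} := by
    rintro ⟨_, g, rfl⟩ P hP
    by_contra hcon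
    refine h.not_isPole_inv_smul htop hq hN0 (hΦ g) hcon ?_
    change ((Φ g)⁻¹ • Φ g • P).IsPole x
    rw [inv_smul_smul]
    exact hP
  have hinv' : ∀ (g : Φ.range) (P : Place K F), P ∈ rationalPlaces K q x y →
      g • P ∈ rationalPlaces K q x y := by
    rintro ⟨_, g, rfl⟩ P hP
    have := h.inv_smul_mem_rationalPlaces (hΦ g⁻¹) hP
    rwa [map_inv, inv_inv] at this
  have hsmall : (∀ P ∈ {P : Place K F | P.IsPole x},
      MulAction.orbit Φ.range P = {P : Place K F | P.IsPole x}) ∧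
      {P : Place K F | P.IsPole x} ∈ shortOrbits Φ.range (Place K F) := by
    obtain ⟨g, hg1, hg⟩ := h.exists_ne_one_isPole hΦ
    refine orbit_eq_and_mem_shortOrbits hne hinv (fun P hP => ?_)
      (h.subsingleton_isPole htop hq hN0 hcop)
      (g := ⟨Φ g, g, rfl⟩) (fun h1 => hg1 (hinj ((congrArg Subtype.val h1).trans (map_one Φ).symm)))
      hg
    obtain ⟨g, hg⟩ := h.exists_smul_isPole hN0 hΦ hP
    exact ⟨⟨Φ g, g, rfl⟩, hg⟩
  have hsmall' : (∀ P ∈ rationalPlaces K q x y,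
      MulAction.orbit Φ.range P = rationalPlaces K q x y) ∧
      rationalPlaces K q x y ∈ shortOrbits Φ.range (Place K F) := by
    obtain ⟨g, hg1, hg⟩ := exists_ne_one_isZero_sub_one hN hΦ
    refine orbit_eq_and_mem_shortOrbits hne' hinv' (fun P hP => ?_)
      (h.subsingleton_isZero_sub_one htop hq hN0)
      (g := ⟨Φ g, g, rfl⟩) (fun h1 => hg1 (hinj ((congrArg Subtype.val h1).trans (map_one Φ).symm)))
      hg
    obtain ⟨g, hg⟩ := exists_smul_isZero_sub_one hΦ hP
    exact ⟨⟨Φ g, g, rfl⟩, hg⟩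
  refine ⟨fun heq => ?_, Set.Subset.antisymm ?_ ?_⟩
  · obtain ⟨P, hP⟩ := hne
    exact hdisj P (heq ▸ hP) hP
  · rintro _ ⟨⟨P, rfl⟩, hcard⟩
    by_cases hP : P.IsPole x
    · exact Or.inl (hsmall.1 P hP)
    by_cases hP' : P ∈ rationalPlaces K q x y
    · exact Or.inr (hsmall'.1 P hP')
    exfalso
    obtain ⟨⟨_, g, rfl⟩, hg1, hg⟩ := (card_orbit_ne_card_iff P).1 hcard
    refine hg1 (Subtype.ext ?_)
    have : g = 1 := h.eq_one_of_smul_eq htop hN0 hΦ hP hP' hg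
    exact (congrArg Φ this).trans (map_one Φ)
  · rintro _ (rfl | rfl)
    exacts [hsmall.2, hsmall'.2]

end

/-! ### The field `K(x, y, z)` and the parameters over the finite field -/

/-- The integer `m` is one more than a multiple of `q (q - 1)`. -/
theorem exists_bmExp_eq {q n : ℕ} (hn : Odd n) (hq : 0 < q) :
    bmExp q n * (q + 1) = q ^ n + 1 ∧ ∃ S, bmExp q n = q * (q - 1) * S + 1 := by
  obtain ⟨j, rfl⟩ := hn
  obtain ⟨r, rfl⟩ : ∃ r, q = r + 1 := ⟨q - 1, by omega⟩
  have hS : ∃ S, ((r + 1) * r * S + 1) * (r + 1 + 1) = (r + 1) ^ (2 * j + 1) + 1 := by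
    induction j with
    | zero => exact ⟨0, by ring⟩
    | succ j ih =>
      obtain ⟨S, hS⟩ := ih
      refine ⟨S + (r + 1) ^ (2 * j), ?_⟩
      have : ((r + 1) * r * (S + (r + 1) ^ (2 * j)) + 1) * (r + 1 + 1) =
          ((r + 1) * r * S + 1) * (r + 1 + 1) +
            (r + 1) * r * (r + 1) ^ (2 * j) * (r + 1 + 1) := by ring
      rw [this, hS]
      ring
  obtain ⟨S, hS⟩ := hS
  have hbm : bmExp (r + 1) (2 * j + 1) = (r + 1) * r * S + 1 :=
    Nat.div_eq_of_eq_mul_left (by omega) hS.symm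
  exact ⟨hbm ▸ hS, S, hbm⟩

namespace YTildeGens

variable {K : Type*} [Field K] {q n s : ℕ} (g : YTildeGens K q n s)

theorem isYTildePoint : IsYTildePoint K q (bmExp q n / s) g.X g.Y g.Z where
  transc := by
    have h1 : Transcendental K (RatFunc.X : RatFunc K) := by
      rw [← RatFunc.algebraMap_X]
      exact (transcendental_algebraMap_iff (RatFunc.algebraMap_injective K)).2
        (Polynomial.transcendental_X K)
    have h2 : Transcendental K (xGen K) :=
      (transcendental_algebraMap_iff (algebraMap (RatFunc K) (RatClosure K)).injective).2 h1
    exact (transcendental_algebraMap_iff (a := g.X) (algebraMap g.field (RatClosure K)).injective).1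
      h2
  y_pow := Subtype.ext g.y_pow
  z_pow := Subtype.ext g.z_pow

theorem adjoin_generators : IntermediateField.adjoin K {g.X, g.Y, g.Z} = ⊤ := by
  apply IntermediateField.lift_injective
  rw [IntermediateField.lift_adjoin, IntermediateField.lift_top]
  simp only [Set.image_insert_eq, Set.image_singleton]
  rfl

section Parameters

variable {k : Type*} [Field k] [Algebra k K] {g}

theorem isLift_iff {t : Matrix (Fin 2) (Fin 2) k × k} {h : GL (Fin 2) K × Kˣ}
    (h1 : ∀ i j, h.1.1 i j = algebraMap k K (t.1 j i)) (h2 : (h.2 : K) = algebraMap k K t.2)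
    (σ : g.field ≃ₐ[K] g.field) : g.IsLift t σ ↔ IsSubstitution g.X g.Y g.Z h σ := by
  unfold IsLift
  simp only [Algebra.smul_def, ← h1, ← h2]
  exact ⟨fun h => ⟨h.1, h.2.1, h.2.2⟩, fun h => ⟨h.1, h.2, h.3⟩⟩

end Parameters

end YTildeGens

section Parameters

variable {k K : Type*} [Field k] [Field K] [Algebra k K] {q n s : ℕ}

theorem exists_liftGroup_of_mem_liftParams (hq : IsCharPower K q) (hN : bmExp q n / s ≠ 0)
    {t : Matrix (Fin 2) (Fin 2) k × k} (ht : t ∈ liftParams k q n s) :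
    ∃ h : liftGroup hq (bmExp q n / s), (∀ i j, h.1.1.1 i j = algebraMap k K (t.1 j i)) ∧
      (h.1.2 : K) = algebraMap k K t.2 := by
  obtain ⟨⟨hpow, -, hac, -⟩, ζ, hζ, hb, hd, hξ⟩ := ht
  have hξ0 : algebraMap k K t.2 ≠ 0 := by
    rw [map_ne_zero]
    intro h0
    rw [h0, zero_pow hN] at hξ
    rw [← hξ, zero_pow q.succ_ne_zero] at hζ
    exact zero_ne_one hζ
  obtain ⟨h, h2, h1⟩ := exists_liftGroup_of_params (hq := hq) (N := bmExp q n / s)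
    (a := algebraMap k K (t.1 0 0)) (c := algebraMap k K (t.1 1 0)) (ξ := algebraMap k K t.2)
    (by rw [← map_pow, hpow]) (by rw [← map_pow, hpow])
    (by rw [← map_pow, ← map_pow, ← map_sub, hac, map_one]) hξ0
    (by rw [← map_pow, ← map_pow, hξ, hζ, map_one])
  refine ⟨h, fun i j => ?_, h2⟩
  rw [h1]
  fin_cases i <;> fin_cases j <;> simp [hb, hd, hξ, ← map_pow, ← map_mul]

/-- All the pairs `(A, ξ)` over `K` have entries in the field of order `q ^ (2 * n)`. -/
theorem exists_mem_liftParams (hk : Nat.card k = q ^ (2 * n)) (hq : IsCharPower K q) (hn : n ≠ 0)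
    (hs : bmExp q n / s * (q + 1) ∣ q ^ n + 1) (h : liftGroup hq (bmExp q n / s)) :
    ∃ t ∈ liftParams k q n s, (∀ i j, h.1.1.1 i j = algebraMap k K (t.1 j i)) ∧
      (h.1.2 : K) = algebraMap k K t.2 := by
  have hq1 := hq.one_lt
  have hent := liftGroup_entries_pow h
  obtain ⟨⟨A, ξ⟩, a, c, ha, hc, hac, hξ, hA⟩ := h
  dsimp only at hA hξ hent ⊢
  have hrange : ∀ u : K, u ^ (q ^ (2 * n)) = u → ∃ a, algebraMap k K a = u := fun u hu =>
    mem_range_of_pow_eq hk (Nat.one_lt_pow (by omega) hq1) (algebraMap k K) hu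
  have hrange' : ∀ u : K, u ^ (q ^ 2) = u → ∃ a, algebraMap k K a = u := by
    intro u hu
    refine hrange u ?_
    rw [pow_mul]
    clear hs hA hk hrange hent hξ
    clear hn
    induction n with
    | zero => simp
    | succ n ih => rw [pow_succ, pow_mul, ih, hu]
  -- The order of `ξ` divides `q ^ n + 1`, which divides `q ^ (2 * n) - 1`.
  obtain ⟨ξ₀, hξ₀⟩ : ∃ a, algebraMap k K a = ξ := by
    refine hrange ξ ?_
    have h1 : (ξ : K) ^ (q ^ n + 1) = 1 := by
      obtain ⟨d, hd⟩ := hs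
      rw [hd, pow_mul, pow_mul, hξ, one_pow]
    refine mul_right_cancel₀ (pow_ne_zero (q ^ n) ξ.ne_zero) ?_
    rw [← pow_succ', h1, ← one_pow (q ^ n), ← h1]
    ring
  choose B hB using fun i j => hrange' _ (hent i j)
  have hinj := (algebraMap k K).injective
  have hB' : ∀ i j, algebraMap k K (B i j) = A.1 i j := hB
  have h00 := hB' 0 0
  have h01 := hB' 0 1
  have h10 := hB' 1 0
  have h11 := hB' 1 1
  rw [hA] at h00 h01 h10 h11
  simp at h00 h01 h10 h11
  have e2 : ∀ u : K, u ^ (q ^ 2) = u → (u ^ q) ^ (q + 1) = u ^ (q + 1) := fun u h => by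
    rw [← pow_mul, show q * (q + 1) = q ^ 2 + q by ring, pow_add, h, pow_succ']
  refine ⟨((Matrix.of B).transpose, ξ₀), ⟨⟨fun i j => ?_, ?_, ?_, ?_⟩, ξ₀ ^ (bmExp q n / s), ?_, ?_,
    ?_, rfl⟩, fun i j => (hB i j).symm, hξ₀.symm⟩
  · refine hinj ?_
    change algebraMap k K (B j i ^ q ^ 2) = algebraMap k K (B j i)
    rw [map_pow, hB]
    exact hent j i
  · refine hinj ?_
    change algebraMap k K (B 1 1 ^ (q + 1) - B 1 0 ^ (q + 1)) = _
    rw [map_sub, map_pow, map_pow, h11, h10, mul_pow, mul_pow, hξ, e2 a ha, e2 c hc, map_one]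
    linear_combination hac
  · refine hinj ?_
    change algebraMap k K (B 0 0 ^ (q + 1) - B 0 1 ^ (q + 1)) = _
    rw [map_sub, map_pow, map_pow, h00, h01, map_one]
    exact hac
  · refine hinj ?_
    change algebraMap k K (-(B 0 0 ^ q * B 1 0) + B 0 1 ^ q * B 1 1) = _
    simp only [map_add, map_neg, map_mul, map_pow, h00, h01, h10, h11, map_zero]
    ring
  · refine hinj ?_
    rw [map_pow, map_pow, hξ₀, hξ, map_one]
  · refine hinj ?_
    change algebraMap k K (B 1 0) = algebraMap k K (ξ₀ ^ (bmExp q n / s) * B 0 1 ^ q)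
    rw [map_mul, map_pow, map_pow, hξ₀, h10, h01]
  · refine hinj ?_
    change algebraMap k K (B 1 1) = algebraMap k K (ξ₀ ^ (bmExp q n / s) * B 0 0 ^ q)
    rw [map_mul, map_pow, map_pow, hξ₀, h11, h00]

end Parameters

theorem isCharPower_of_card {k K : Type*} [Field k] [Field K] [Algebra k K] {q d : ℕ}
    (hq : IsPrimePow q) (hk : Nat.card k = q ^ d) : IsCharPower K q := by
  obtain ⟨p, r, hp, hr, rfl⟩ := hq
  have hp' := hp.nat_prime
  have : Fact p.Prime := ⟨hp'⟩
  have hc : CharP k p := by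
    have : Finite k := Nat.finite_of_card_ne_zero (by
      rw [hk]
      exact pow_ne_zero _ (pow_ne_zero _ hp'.ne_zero))
    have := Fintype.ofFinite k
    rw [← pow_mul, Nat.card_eq_fintype_card] at hk
    exact charP_of_card_eq_prime_pow hk
  exact IsCharPower.of_algebra (K := k) ⟨p, r, hp', hr.ne', hc, rfl⟩

/-- The field of order `q` embeds into every algebraically closed field of the same
characteristic. -/
theorem nonempty_ringHom_of_card {Fq K : Type*} [Field Fq] [Field K] [IsAlgClosed K] {q : ℕ}
    (hFq : Nat.card Fq = q) (hq : IsCharPower K q) : Nonempty (Fq →+* K) := by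
  obtain ⟨p, r, hp, hr, _, rfl⟩ := hq
  have : Fact p.Prime := ⟨hp⟩
  have : Finite Fq := Nat.finite_of_card_ne_zero (by
    rw [hFq]
    exact pow_ne_zero _ hp.ne_zero)
  have := Fintype.ofFinite Fq
  rw [Nat.card_eq_fintype_card] at hFq
  have := charP_of_card_eq_prime_pow hFq
  algebraize [ZMod.castHom (dvd_refl p) Fq, ZMod.castHom (dvd_refl p) K]
  exact ⟨(IsAlgClosed.lift : Fq →ₐ[ZMod p] K).toRingHom⟩

theorem mainTheorem11
    (q n s : ℕ) (hq : IsPrimePow q) (hn : 3 ≤ n) (hn_odd : Odd n) (hs : s ∣ bmExp q n)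
    {Fq k K : Type*} [Field Fq] [Field k] [Field K] [Algebra k K]
    (hFq : Nat.card Fq = q) (hk : Nat.card k = q ^ (2 * n)) [IsAlgClosure k K]
    (g : YTildeGens K q n s) :
    ∃ G : Subgroup (g.field ≃ₐ[K] g.field),
      (∀ σ : g.field ≃ₐ[K] g.field, σ ∈ G ↔ ∃ t ∈ liftParams k q n s, g.IsLift t σ) ∧
      (∀ t ∈ liftParams k q n s, ∃ σ ∈ G, g.IsLift t σ) ∧
      (∃ φ : Multiplicative (ZMod ((q ^ n + 1) / s)) →*
            MulAut (Matrix.SpecialLinearGroup (Fin 2) Fq),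
        Nonempty (G ≃* Matrix.SpecialLinearGroup (Fin 2) Fq ⋊[φ]
          Multiplicative (ZMod ((q ^ n + 1) / s)))) ∧
      g.orbitInfty ≠ g.orbitZero ∧
      shortOrbits G (Place K g.field) = {g.orbitInfty, g.orbitZero} := by
  have : IsAlgClosed K := IsAlgClosure.isAlgClosed k
  have hqK : IsCharPower K q := isCharPower_of_card hq hk
  have hq1 := hqK.one_lt
  obtain ⟨hbm, S, hS⟩ := exists_bmExp_eq hn_odd (by omega : 0 < q)
  have hsN : bmExp q n / s * s = bmExp q n := Nat.div_mul_cancel hs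
  have hs0 : s ≠ 0 := by
    rintro rfl
    omega
  have hN0 : bmExp q n / s ≠ 0 := by
    intro h0
    rw [h0] at hsN
    omega
  have horder : (q ^ n + 1) / s = bmExp q n / s * (q + 1) := by
    refine Nat.div_eq_of_eq_mul_left (Nat.pos_of_ne_zero hs0) ?_
    rw [← hbm, ← hsN, Nat.mul_div_cancel _ (Nat.pos_of_ne_zero hs0)]
    ring
  have hdvd : bmExp q n / s * (q + 1) ∣ q ^ n + 1 :=
    hbm ▸ Nat.mul_dvd_mul_right (Nat.div_dvd_of_dvd hs) _
  have hNK : ((bmExp q n / s : ℕ) : K) ≠ 0 := by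
    intro h0
    have h1 := congrArg (Nat.cast : ℕ → K) hsN
    rw [Nat.cast_mul, h0, zero_mul, hS] at h1
    simp [hqK.cast_eq_zero] at h1
  have hcop : (bmExp q n / s).Coprime (q * (q - 1)) := by
    refine Nat.Coprime.coprime_dvd_left (Nat.div_dvd_of_dvd hs) ?_
    rw [hS]
    simp
  have hg := g.isYTildePoint
  have htop := g.adjoin_generators
  obtain ⟨Φ, hinj, hΦ⟩ := hg.exists_action htop hqK hN0
  obtain ⟨ι⟩ := nonempty_ringHom_of_card hFq hqK
  obtain ⟨φ, ⟨e⟩⟩ := nonempty_liftGroup_mulEquiv hFq ι hqK hNK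
  have e' := (MonoidHom.ofInjective hinj).symm.trans e
  have : Finite Φ.range := by
    have : Finite Fq := Nat.finite_of_card_ne_zero (by omega)
    have : NeZero (bmExp q n / s * (q + 1)) := ⟨Nat.mul_ne_zero hN0 q.succ_ne_zero⟩
    have : Finite (Matrix.SpecialLinearGroup (Fin 2) Fq) := Subtype.finite
    exact Finite.of_equiv _ (e'.toEquiv.trans SemidirectProduct.equivProd).symm
  refine ⟨Φ.range, fun σ => ⟨?_, ?_⟩, fun t ht => ?_, ?_,
    hg.shortOrbits_range htop hNK hcop hinj hΦ⟩
  · rintro ⟨h, rfl⟩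
    obtain ⟨t, ht, h1, h2⟩ := exists_mem_liftParams hk hqK (by omega) hdvd h
    exact ⟨t, ht, (YTildeGens.isLift_iff h1 h2 _).2 (hΦ h)⟩
  · rintro ⟨t, ht, hσ⟩
    obtain ⟨h, h1, h2⟩ := exists_liftGroup_of_mem_liftParams hqK hN0 ht
    exact ⟨h, (hΦ h).eq htop ((YTildeGens.isLift_iff h1 h2 _).1 hσ)⟩
  · obtain ⟨h, h1, h2⟩ := exists_liftGroup_of_mem_liftParams hqK hN0 ht
    exact ⟨Φ h, ⟨h, rfl⟩, (YTildeGens.isLift_iff h1 h2 _).2 (hΦ h)⟩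
  · rw [horder]
    exact ⟨φ, ⟨e'⟩⟩
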